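/- For complex $x,q$ and $n\ge 0$ put $(x;q)_n=\prod_{j=0}^{n-1}(1-xq^j)$ and $(x_1,\dots,x_r;q)_n=\prod_i (x_i;q)_n$. For $|q|<1$ let $a(q)=\sum_{m,n=-\infty}^{\infty}q^{m^2+mn+n^2}$ be the cubic theta function of the Borweins. A pair of complex sequences $(\alpha_n,\beta_n)_{n\ge0}$ is a Bailey pair with respect to $a$ in base $q$ if $\alpha_0=\beta_0=1$ and $\beta_n=\sum_{j=0}^{n}\frac{\alpha_j}{(q;q)_{n-j}(aq;q)_{n+j}}$ for $n>0$. (1) For every complex $q$ with $|q|<1$, the double series for $a(q)$ and all series below converge absolutely, and $$a(q)=1-6\sum_{n=1}^{\infty}\frac{(-1)^n q^{(3n^2-n)/2}}{(q;q^3)_n(1-q^{3n})}+6\sum_{n=1}^{\infty}\frac{(-1)^n q^{(3n^2+n)/2}}{(q^2;q^3)_n(1-q^{3n})}$$ $$=1+6\sum_{n=1}^{\infty}\frac{q^{3n^2-2n}(1-q^{6n-2})}{(1-q^{3n-2})(1-q^{3n})}-6\sum_{n=1}^{\infty}\frac{q^{3n^2-n}(1-q^{6n-1})}{(1-q^{3n-1})(1-q^{3n})}.$$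 (2) Let $0<|q|<1$ and let $(\alpha_n(a,q),\beta_n(a,q))$ be a Bailey pair in which $a$ is a free parameter (it is only needed that $(\alpha_n(a,q^3),\beta_n(a,q^3))$ is a Bailey pair with respect to $a$ in base $q^3$ for $a=q^{-1}$ and for $a=q^{-2}$). If the two series below that contain the $\alpha_n$ converge, then so do the two series that contain the $\beta_n$, and $$a(q)=1+6\sum_{n=1}^{\infty}(q^3;q^3)_{n-1}(-1)^nq^{(3n^2+n)/2}\beta_n(q^{-1},q^3)-6\sum_{n=1}^{\infty}(q^3;q^3)_{n-1}(-1)^nq^{(3n^2-n)/2}\beta_n(q^{-2},q^3)$$ $$-6\sum_{n=1}^{\infty}\frac{(q^3;q^3)_{n-1}(-1)^nq^{(3n^2+n)/2}\alpha_n(q^{-1},q^3)}{(q^2;q^3)_n}+6\sum_{n=1}^{\infty}\frac{(q^3;q^3)_{n-1}(-1)^nq^{(3n^2-n)/2}\alpha_n(q^{-2},q^3)}{(q;q^3)_n}.$$ (3) Let $0<|q|<1$ and let $c,d$ be nonzero complex numbers such that no denominator below vanishes, that is, neither $c$ nor $d$ is of the form $q^{3m+1}$ or $q^{3m+2}$ with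 an integer $m\ge0$. Then all series below converge absolutely and $$a(q)=1+6\sum_{n=1}^{\infty}\frac{(q^3;q^3)_{n-1}(q^2/cd;q^3)_n(-1)^nq^{(3n^2+n)/2}}{(q^2/c,q^2/d,q^3;q^3)_n}-6\sum_{n=1}^{\infty}\frac{(q^3;q^3)_{n-1}(q/cd;q^3)_n(-1)^nq^{(3n^2-n)/2}}{(q/c,q/d,q^3;q^3)_n}$$ $$-6\sum_{n=1}^{\infty}\frac{(1-q^{6n-1})(q^3;q^3)_{n-1}(1/q,c,d;q^3)_n\,q^{3n^2+n}}{(1-1/q)(q^2/c,q^2/d,q^2,q^3;q^3)_n\,c^nd^n}+6\sum_{n=1}^{\infty}\frac{(1-q^{6n-2})(q^3;q^3)_{n-1}(1/q^2,c,d;q^3)_n\,q^{3n^2-n}}{(1-1/q^2)(q/c,q/d,q,q^3;q^3)_n\,c^nd^n}.$$ -/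

import Mathlib

open Filter Topology

/-- The finite `q`-shifted factorial `(x; q)_n = (1 - x)(1 - x q) ⋯ (1 - x q^(n-1))`. -/
noncomputable def qPoch (x q : ℂ) (n : ℕ) : ℂ :=
  ∏ j ∈ Finset.range n, (1 - x * q ^ j)

/-- The Borweins' cubic theta function `a(q) = ∑_{m, n ∈ ℤ} q^(m² + m n + n²)`. -/
noncomputable def cubicTheta (q : ℂ) : ℂ :=
  ∑' p : ℤ × ℤ, q ^ (p.1 ^ 2 + p.1 * p.2 + p.2 ^ 2)

/-- `(α_n, β_n)` is a Bailey pair with respect to `a` (in base `q`): `α_0 = β_0 = 1` and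
`β_n = ∑_{j=0}^n α_j / ((q; q)_{n-j} (a q; q)_{n+j})` for `n > 0`. -/
def IsBaileyPair (a q : ℂ) (α β : ℕ → ℂ) : Prop :=
  α 0 = 1 ∧ β 0 = 1 ∧
    ∀ n : ℕ, 0 < n →
      β n = ∑ j ∈ Finset.range (n + 1),
        1 / (qPoch q q (n - j) * qPoch (a * q) q (n + j)) * α j

/-- The series `∑_{n ≥ 1} u n` converges (in the ordinary sense of partial sums) to `S`. -/
def SeriesTendsTo (u : ℕ → ℂ) (S : ℂ) : Prop :=
  Tendsto (fun N : ℕ => ∑ n ∈ Finset.Icc 1 N, u n) atTop (𝓝 S)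

/-! Put L(x; p) = ∑_{m≥1} x^m / (1 - p^m), which also equals ∑_{i≥0} x p^i / (1 - x p^i). Everything
rests on a(q) = 1 + 6 (L(q; q³) - L(q²; q³)), proved in `cubicTheta_eq_lambertSeries`; each formula
of the theorem then replaces the two values of L by another expansion, always with p = q³ and x = q
or x = q².

Part (1) uses two expansions of L, `hasSum_alternating` and `hasSum_durfee`. A series ∑ u_n(y) of
size O(|y|) equals L as soon as ∑ (u_n(y) - u_n(y p)) telescopes to y / (1 - y), and in both cases
an explicit certificate does this.

Part (2) is a Bailey transform with x = a p (`tendsto_baileyTransform`). Insert the definition of β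
into the weighted series and exchange the summations. The contribution of α_0 = 1 is minus the
alternating expansion of L. Every other α_j is multiplied by a ₁φ₁ series summed in closed form by
`tsum_phiTerm`. Since the α-series may converge only conditionally, the exchange is done on partial
sums with a uniform tail estimate.

Part (3) applies this transform to a pair with two parameters (`sum_wellPoisedAlpha`, a terminating
very-well-poised ₆φ₅ sum proved by creative telescoping), whose series converge absolutely.

For the Lambert expansion of a(q), let θ(z) = ∑ (-1)^k q^(k(k-1)/2) z^k. Averaging θ³ over the cube
roots of unity keeps the triples of indices whose sum is 3m, and centring these at m gives a(q)
times the theta series of base q³ at z³ (`sum_thetaTerm_cube`). Both sides vanish at z = 1.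
Comparing derivatives there, with the Jacobi triple product for the values of θ, expresses a(q) by
logarithmic derivatives of ∏ (1 - z q^n) at the primitive cube roots of unity; combining fractions
produces L. -/

/-! ### Finite q-shifted factorials and uniform bounds for them. -/

section QPochhammer

variable {p : ℂ}

@[simp] lemma qPoch_zero (x p : ℂ) : qPoch x p 0 = 1 := by simp [qPoch]

lemma qPoch_succ (x p : ℂ) (n : ℕ) : qPoch x p (n + 1) = qPoch x p n * (1 - x * p ^ n) := by
  simp [qPoch, Finset.prod_range_succ]

lemma qPoch_one (x p : ℂ) : qPoch x p 1 = 1 - x := by simp [qPoch]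

lemma qPoch_succ_left (x p : ℂ) (n : ℕ) :
    qPoch x p (n + 1) = (1 - x) * qPoch (x * p) p n := by
  simp only [qPoch, Finset.prod_range_succ', pow_zero, mul_one]
  rw [mul_comm]
  congr 1
  exact Finset.prod_congr rfl fun j _ => by ring

lemma qPoch_add (x p : ℂ) (m n : ℕ) :
    qPoch x p (m + n) = qPoch x p m * qPoch (x * p ^ m) p n := by
  simp only [qPoch, Finset.prod_range_add]
  congr 1
  exact Finset.prod_congr rfl fun j _ => by ring

lemma qPoch_ne_zero {x p : ℂ} (h : ∀ j, 1 - x * p ^ j ≠ 0) (n : ℕ) : qPoch x p n ≠ 0 :=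
  Finset.prod_ne_zero_iff.2 fun j _ => h j

lemma sum_norm_geom_le (hp : ‖p‖ < 1) (y : ℝ) (hy : 0 ≤ y) (n : ℕ) :
    ∑ j ∈ Finset.range n, y * ‖p‖ ^ j ≤ y / (1 - ‖p‖) := by
  rw [← Finset.mul_sum, div_eq_mul_inv]
  gcongr
  rw [← tsum_geometric_of_lt_one (norm_nonneg p) hp]
  exact (summable_geometric_of_lt_one (norm_nonneg p) hp).sum_le_tsum _
    fun _ _ => by positivity

lemma norm_prod_one_add_le (f : ℕ → ℂ) (n : ℕ) :
    ‖∏ j ∈ Finset.range n, (1 + f j)‖ ≤ Real.exp (∑ j ∈ Finset.range n, ‖f j‖) := by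
  rw [norm_prod, Real.exp_sum]
  refine Finset.prod_le_prod (fun _ _ => norm_nonneg _) fun j _ => ?_
  calc ‖1 + f j‖ ≤ ‖(1 : ℂ)‖ + ‖f j‖ := norm_add_le _ _
    _ = ‖f j‖ + 1 := by rw [norm_one, add_comm]
    _ ≤ _ := Real.add_one_le_exp _

lemma norm_qPoch_le (hp : ‖p‖ < 1) (x : ℂ) (n : ℕ) :
    ‖qPoch x p n‖ ≤ Real.exp (‖x‖ / (1 - ‖p‖)) := by
  have h := norm_prod_one_add_le (fun j => -(x * p ^ j)) n
  simp only [← sub_eq_add_neg, norm_neg, norm_mul, norm_pow] at h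
  exact h.trans (Real.exp_le_exp.2 (sum_norm_geom_le hp _ (norm_nonneg x) n))

/-- Since 1 / (1 - t) = 1 + t / (1 - t), the inverse is again a product of factors 1 + f_j with
geometrically bounded f_j, so the exponential bound applies to it too. -/
lemma norm_qPoch_inv_le (hp : ‖p‖ < 1) {x : ℂ} {K : ℝ} (h0 : ∀ j, 1 - x * p ^ j ≠ 0)
    (hK : ∀ j, ‖(1 - x * p ^ j)⁻¹‖ ≤ K) (n : ℕ) :
    ‖(qPoch x p n)⁻¹‖ ≤ Real.exp (K * ‖x‖ / (1 - ‖p‖)) := by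
  have hK0 : 0 ≤ K := (norm_nonneg _).trans (hK 0)
  have h := norm_prod_one_add_le (fun j => x * p ^ j * (1 - x * p ^ j)⁻¹) n
  have e : ∏ j ∈ Finset.range n, (1 + x * p ^ j * (1 - x * p ^ j)⁻¹) = (qPoch x p n)⁻¹ := by
    rw [qPoch, ← Finset.prod_inv_distrib]
    refine Finset.prod_congr rfl fun j _ => ?_
    have := h0 j
    field_simp
    ring
  rw [e] at h
  refine h.trans (Real.exp_le_exp.2 (le_trans ?_ (sum_norm_geom_le hp _ (by positivity) n)))
  refine Finset.sum_le_sum fun j _ => ?_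
  rw [norm_mul, norm_mul, norm_pow]
  calc ‖x‖ * ‖p‖ ^ j * ‖(1 - x * p ^ j)⁻¹‖ ≤ ‖x‖ * ‖p‖ ^ j * K := by gcongr; exact hK j
    _ = _ := by ring

lemma norm_mul_pow_le (hp : ‖p‖ < 1) (x : ℂ) (j : ℕ) : ‖x * p ^ j‖ ≤ ‖x‖ := by
  rw [norm_mul, norm_pow]
  exact mul_le_of_le_one_right (norm_nonneg x) (pow_le_one₀ (norm_nonneg p) hp.le)

lemma one_sub_ne_zero_of_norm_lt {x : ℂ} (hx : ‖x‖ < 1) : 1 - x ≠ 0 := by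
  intro h
  rw [← sub_eq_zero.1 h, norm_one] at hx
  exact lt_irrefl _ hx

lemma one_sub_mul_pow_ne_zero (hp : ‖p‖ < 1) {x : ℂ} (hx : ‖x‖ < 1) (j : ℕ) :
    1 - x * p ^ j ≠ 0 :=
  one_sub_ne_zero_of_norm_lt ((norm_mul_pow_le hp x j).trans_lt hx)

lemma norm_inv_one_sub_le {x : ℂ} {ρ : ℝ} (hx : ‖x‖ ≤ ρ) (hρ : ρ < 1) :
    ‖(1 - x)⁻¹‖ ≤ (1 - ρ)⁻¹ := by
  rw [norm_inv]
  have h := norm_sub_norm_le (1 : ℂ) x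
  rw [norm_one] at h
  exact inv_anti₀ (by linarith) (by linarith)

lemma norm_qPoch_inv_le_of_norm_le (hp : ‖p‖ < 1) {x : ℂ} {ρ : ℝ} (hx : ‖x‖ ≤ ρ) (hρ : ρ < 1)
    (n : ℕ) : ‖(qPoch x p n)⁻¹‖ ≤ Real.exp ((1 - ρ)⁻¹ * ρ / (1 - ‖p‖)) := by
  have h1 : (0 : ℝ) < 1 - ‖p‖ := by linarith
  have h2 : (0 : ℝ) < 1 - ρ := by linarith
  refine (norm_qPoch_inv_le hp (one_sub_mul_pow_ne_zero hp (hx.trans_lt hρ))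
    (fun j => norm_inv_one_sub_le ((norm_mul_pow_le hp x j).trans hx) hρ) n).trans ?_
  gcongr

lemma tendsto_mul_pow_zero (hp : ‖p‖ < 1) (x : ℂ) :
    Tendsto (fun j : ℕ => x * p ^ j) atTop (𝓝 0) := by
  simpa using (tendsto_pow_atTop_nhds_zero_of_norm_lt_one hp).const_mul x

/-- The factors tend to 1 and none vanishes, so their inverses are bounded. No size restriction on x
is needed, which matters for arguments such as a p / c. -/
lemma exists_norm_qPoch_inv_le (hp : ‖p‖ < 1) {x : ℂ} (h0 : ∀ j, 1 - x * p ^ j ≠ 0) :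
    ∃ C : ℝ, ∀ n, ‖(qPoch x p n)⁻¹‖ ≤ C := by
  have h : Tendsto (fun j : ℕ => ‖(1 - x * p ^ j)⁻¹‖) atTop (𝓝 ‖((1 : ℂ) - 0)⁻¹‖) :=
    (((tendsto_mul_pow_zero hp x).const_sub 1).inv₀ (by simp)).norm
  obtain ⟨K, hK⟩ := h.bddAbove_range
  exact ⟨_, norm_qPoch_inv_le hp h0 fun j => hK ⟨j, rfl⟩⟩

lemma summable_pow_choose_two_mul_pow {r : ℝ} (hr : 0 ≤ r) (hr1 : r < 1) (b : ℝ) :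
    Summable fun k : ℕ => r ^ (k.choose 2) * b ^ k := by
  have h : Tendsto (fun k : ℕ => r ^ k * |b|) atTop (𝓝 0) := by
    simpa using (tendsto_pow_atTop_nhds_zero_of_lt_one hr hr1).mul_const |b|
  refine summable_of_ratio_norm_eventually_le (r := 1 / 2) (by norm_num) ?_
  filter_upwards [h.eventually (gt_mem_nhds (show (0 : ℝ) < 1 / 2 by norm_num))] with k hk
  have e : ‖r ^ ((k + 1).choose 2) * b ^ (k + 1)‖ =
      r ^ k * |b| * ‖r ^ (k.choose 2) * b ^ k‖ := by
    rw [Nat.choose_succ_succ' k 1, Nat.choose_one_right]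
    simp only [norm_mul, norm_pow, Real.norm_eq_abs, abs_of_nonneg hr]
    ring
  rw [e]
  gcongr

end QPochhammer

/-! ### Lambert series and their expansions by p-difference telescoping. -/

section LambertSeries

variable {p : ℂ}

lemma tendsto_zero_of_norm_le_mul_pow {A : ℕ → ℂ} {C r : ℝ} (hr0 : 0 ≤ r) (hr : r < 1)
    (h : ∀ n, ‖A n‖ ≤ C * r ^ n) : Tendsto A atTop (𝓝 0) :=
  squeeze_zero_norm h (by simpa using (tendsto_pow_atTop_nhds_zero_of_lt_one hr0 hr).const_mul C)

lemma tsum_eq_of_telescoping {f A : ℕ → ℂ} (hf : Summable f) (h : ∀ n, f n = A n - A (n + 1))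
    (hA : Tendsto A atTop (𝓝 0)) : ∑' n, f n = A 0 := by
  refine tendsto_nhds_unique hf.hasSum.tendsto_sum_nat ?_
  simp only [h, Finset.sum_range_sub']
  simpa using hA.const_sub (A 0)

/-- A series whose `p`-difference telescopes to `y / (1 - y)` is the Lambert series
`∑ x p^i / (1 - x p^i)`. -/
lemma tendsto_sum_of_pDifference (hp : ‖p‖ < 1) {x : ℂ} {u A : ℂ → ℕ → ℂ} {b : ℕ → ℝ}
    (hb : Summable b) (hu : ∀ y, ‖y‖ ≤ ‖x‖ → ∀ n, ‖u y n‖ ≤ ‖y‖ * b n)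
    (hA : ∀ y, ‖y‖ ≤ ‖x‖ → Tendsto (A y) atTop (𝓝 0))
    (hA0 : ∀ y, ‖y‖ ≤ ‖x‖ → A y 0 = y / (1 - y))
    (h : ∀ y, ‖y‖ ≤ ‖x‖ → ∀ n, u y n - u (y * p) n = A y n - A y (n + 1)) :
    Tendsto (fun k => ∑ i ∈ Finset.range k, x * p ^ i / (1 - x * p ^ i)) atTop
      (𝓝 (∑' n, u x n)) := by
  have hs : ∀ y, ‖y‖ ≤ ‖x‖ → Summable (u y) := fun y hy =>
    Summable.of_norm_bounded (hb.mul_left ‖y‖) (hu y hy)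
  have hk : ∀ k, ‖x * p ^ k‖ ≤ ‖x‖ := norm_mul_pow_le hp x
  -- Iterating the p-difference along y = x, x p, x p², … leaves the remainder ∑ u(x p^k), which
  -- tends to 0 because of the factor ‖y‖ in the bound on u.
  have hstep : ∀ k, ∑ i ∈ Finset.range k, x * p ^ i / (1 - x * p ^ i) =
      ∑' n, u x n - ∑' n, u (x * p ^ k) n := by
    intro k
    induction k with
    | zero => simp
    | succ k ih =>
      have h1 := tsum_eq_of_telescoping
        ((hs _ (hk k)).sub (by simpa [pow_succ, mul_assoc] using hs _ (hk (k + 1))))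
        (h _ (hk k)) (hA _ (hk k))
      rw [(hs _ (hk k)).tsum_sub (by simpa [pow_succ, mul_assoc] using hs _ (hk (k + 1))),
        hA0 _ (hk k)] at h1
      rw [Finset.sum_range_succ, ih, ← h1]
      simp [pow_succ, mul_assoc]
  have hlim : Tendsto (fun k => ∑' n, u (x * p ^ k) n) atTop (𝓝 0) := by
    refine squeeze_zero_norm (a := fun k => ‖x * p ^ k‖ * ∑' n, b n) (fun k => ?_) ?_
    · exact tsum_of_norm_bounded (hb.hasSum.mul_left _) (hu _ (hk k))
    · simpa using (tendsto_mul_pow_zero hp x).norm.mul_const (∑' n, b n)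
  simp only [hstep]
  simpa using hlim.const_sub (∑' n, u x n)

/-- The Lambert series `∑_{m ≥ 1} x^m / (1 - p^m)`. -/
noncomputable def lambertSeries (x p : ℂ) : ℂ := ∑' n : ℕ, x ^ (n + 1) / (1 - p ^ (n + 1))

lemma norm_pow_succ_lt_one (hp : ‖p‖ < 1) (n : ℕ) : ‖p ^ (n + 1)‖ < 1 := by
  rw [norm_pow]
  exact pow_lt_one₀ (norm_nonneg p) hp n.succ_ne_zero

lemma norm_pow_succ_le (hp : ‖p‖ < 1) (n : ℕ) : ‖p ^ (n + 1)‖ ≤ ‖p‖ := by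
  rw [norm_pow]
  exact pow_le_of_le_one (norm_nonneg p) hp.le n.succ_ne_zero

lemma one_sub_pow_succ_ne_zero (hp : ‖p‖ < 1) (n : ℕ) : 1 - p ^ (n + 1) ≠ 0 :=
  one_sub_ne_zero_of_norm_lt (norm_pow_succ_lt_one hp n)

lemma norm_pow_le_one (hp : ‖p‖ < 1) (n : ℕ) : ‖p ^ n‖ ≤ 1 := by
  rw [norm_pow]
  exact pow_le_one₀ (norm_nonneg p) hp.le

lemma norm_inv_one_sub_pow_succ_le (hp : ‖p‖ < 1) (n : ℕ) :
    ‖(1 - p ^ (n + 1))⁻¹‖ ≤ (1 - ‖p‖)⁻¹ :=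
  norm_inv_one_sub_le (norm_pow_succ_le hp n) hp

lemma norm_lambertSeries_term_le (hp : ‖p‖ < 1) {x y : ℂ} (hy : ‖y‖ ≤ ‖x‖) (n : ℕ) :
    ‖y ^ (n + 1) / (1 - p ^ (n + 1))‖ ≤ ‖y‖ * (‖x‖ ^ n * (1 - ‖p‖)⁻¹) := by
  rw [div_eq_mul_inv, norm_mul, norm_pow, pow_succ']
  have := norm_inv_one_sub_pow_succ_le hp n
  calc ‖y‖ * ‖y‖ ^ n * ‖(1 - p ^ (n + 1))⁻¹‖ ≤ ‖y‖ * ‖x‖ ^ n * (1 - ‖p‖)⁻¹ := by gcongr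
    _ = _ := by ring

lemma summable_lambertSeries (hp : ‖p‖ < 1) {x : ℂ} (hx : ‖x‖ < 1) :
    Summable fun n : ℕ => x ^ (n + 1) / (1 - p ^ (n + 1)) :=
  Summable.of_norm_bounded (((summable_geometric_of_lt_one (norm_nonneg x) hx).mul_right
    _).mul_left _) (norm_lambertSeries_term_le hp le_rfl)

/-- The defining series itself fits the telescoping scheme: its p-difference is the geometric series
∑ y^(n+1). This links L to the limit shared by the other expansions. -/
lemma tendsto_sum_lambertSeries (hp : ‖p‖ < 1) {x : ℂ} (hx : ‖x‖ < 1) :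
    Tendsto (fun k => ∑ i ∈ Finset.range k, x * p ^ i / (1 - x * p ^ i)) atTop
      (𝓝 (lambertSeries x p)) := by
  refine tendsto_sum_of_pDifference hp (u := fun y n => y ^ (n + 1) / (1 - p ^ (n + 1)))
    (A := fun y n => y ^ (n + 1) / (1 - y))
    ((summable_geometric_of_lt_one (norm_nonneg x) hx).mul_right _)
    (fun y hy n => norm_lambertSeries_term_le hp hy n) (fun y hy => ?_) (fun y _ => by simp)
    (fun y hy n => ?_)
  · have := (tendsto_pow_atTop_nhds_zero_of_norm_lt_one (hy.trans_lt hx)).comp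
      (tendsto_add_atTop_nat 1)
    simpa using this.div_const (1 - y)
  · have h1 := one_sub_pow_succ_ne_zero hp n
    have h2 := one_sub_ne_zero_of_norm_lt (hy.trans_lt hx)
    rw [mul_pow]
    generalize p ^ (n + 1) = P at *
    field_simp
    ring

lemma norm_div_qPoch_le (hp : ‖p‖ < 1) {x y : ℂ} (hx : ‖x‖ < 1) (hy : ‖y‖ ≤ ‖x‖) (m k n : ℕ) :
    ‖(-1) ^ m * p ^ k * y ^ n / qPoch y p n‖ ≤
      ‖y‖ ^ n * Real.exp ((1 - ‖x‖)⁻¹ * ‖x‖ / (1 - ‖p‖)) := by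
  rw [div_eq_mul_inv, norm_mul, norm_mul, norm_mul, norm_pow, norm_neg, norm_one, one_pow,
    one_mul, norm_pow y]
  have h1 := norm_qPoch_inv_le_of_norm_le hp hy hx n
  have h2 := norm_pow_le_one hp k
  gcongr
  exact mul_le_of_le_one_left (by positivity) h2

lemma norm_alternating_term_le (hp : ‖p‖ < 1) {x y : ℂ} (hx : ‖x‖ < 1) (hy : ‖y‖ ≤ ‖x‖)
    (n : ℕ) :
    ‖(-1) ^ n * p ^ ((n + 1).choose 2) * y ^ (n + 1) /
        (qPoch y p (n + 1) * (1 - p ^ (n + 1)))‖ ≤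
      ‖y‖ * (‖x‖ ^ n * (Real.exp ((1 - ‖x‖)⁻¹ * ‖x‖ / (1 - ‖p‖)) * (1 - ‖p‖)⁻¹)) := by
  rw [← div_div, div_eq_mul_inv, norm_mul]
  have h1 := norm_div_qPoch_le hp hx hy n ((n + 1).choose 2) (n + 1)
  have h2 := norm_inv_one_sub_pow_succ_le hp n
  calc _ ≤ (‖y‖ ^ (n + 1) * Real.exp ((1 - ‖x‖)⁻¹ * ‖x‖ / (1 - ‖p‖))) * (1 - ‖p‖)⁻¹ := by
        gcongr
    _ = ‖y‖ * (‖y‖ ^ n * (Real.exp ((1 - ‖x‖)⁻¹ * ‖x‖ / (1 - ‖p‖)) * (1 - ‖p‖)⁻¹)) := by ring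
    _ ≤ _ := by
        have : (0 : ℝ) < (1 - ‖p‖)⁻¹ := inv_pos.2 (by linarith)
        gcongr

/-- The certificate is the general term without its factor 1 / (1 - p^(n+1)). -/
lemma hasSum_alternating (hp : ‖p‖ < 1) {x : ℂ} (hx : ‖x‖ < 1) :
    HasSum (fun n : ℕ => (-1) ^ n * p ^ ((n + 1).choose 2) * x ^ (n + 1) /
      (qPoch x p (n + 1) * (1 - p ^ (n + 1)))) (lambertSeries x p) := by
  have hb := (summable_geometric_of_lt_one (norm_nonneg x) hx).mul_right
    (Real.exp ((1 - ‖x‖)⁻¹ * ‖x‖ / (1 - ‖p‖)) * (1 - ‖p‖)⁻¹)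
  have hs := Summable.of_norm_bounded (hb.mul_left ‖x‖) (norm_alternating_term_le hp hx le_rfl)
  rw [tendsto_nhds_unique (tendsto_sum_lambertSeries hp hx)
    (tendsto_sum_of_pDifference hp (u := fun y n => (-1) ^ n * p ^ ((n + 1).choose 2) *
      y ^ (n + 1) / (qPoch y p (n + 1) * (1 - p ^ (n + 1))))
    (A := fun y n => (-1) ^ n * p ^ ((n + 1).choose 2) * y ^ (n + 1) / qPoch y p (n + 1))
    hb (fun y hy n => norm_alternating_term_le hp hx hy n) (fun y hy => ?_)
    (fun y _ => by simp [qPoch_one]) (fun y hy n => ?_))]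
  · exact hs.hasSum
  · refine tendsto_zero_of_norm_le_mul_pow (norm_nonneg y) (hy.trans_lt hx)
      (C := ‖y‖ * Real.exp ((1 - ‖x‖)⁻¹ * ‖x‖ / (1 - ‖p‖))) fun n => ?_
    exact (norm_div_qPoch_le hp hx hy n _ (n + 1)).trans_eq (by ring)
  · have h1 := one_sub_pow_succ_ne_zero hp n
    have h2 := one_sub_mul_pow_ne_zero hp (hy.trans_lt hx)
    have h3 := qPoch_ne_zero h2 (n + 1)
    have h5 : 1 - y ≠ 0 := by simpa using h2 0
    have h4 : qPoch (y * p) p (n + 1) = qPoch y p (n + 1) * (1 - y * p ^ (n + 1)) / (1 - y) := by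
      rw [← qPoch_succ, qPoch_succ_left y p (n + 1), mul_div_cancel_left₀ _ h5]
    have h6 := h2 (n + 1)
    rw [mul_comm] at h6
    rw [h4, qPoch_succ _ _ (n + 1), mul_pow, Nat.choose_succ_succ' (n + 1) 1,
      Nat.choose_one_right, pow_add p (n + 1) ((n + 1).choose 2), pow_succ y (n + 1), pow_succ (-1 : ℂ) n]
    generalize p ^ (n + 1) = P at *
    generalize qPoch y p (n + 1) = Q at *
    generalize p ^ ((n + 1).choose 2) = R at *
    generalize y ^ (n + 1) = Y at *
    generalize (-1 : ℂ) ^ n = s at *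
    field_simp
    ring

lemma norm_durfee_term_le (hp : ‖p‖ < 1) {x y : ℂ} (hx : ‖x‖ < 1) (hy : ‖y‖ ≤ ‖x‖) (n : ℕ) :
    ‖p ^ (n * (n + 1)) * y ^ (n + 1) / (1 - y * p ^ n) +
        p ^ ((n + 1) * (n + 1)) * y ^ (n + 1) / (1 - p ^ (n + 1))‖ ≤
      ‖y‖ * (‖x‖ ^ n * ((1 - ‖x‖)⁻¹ + (1 - ‖p‖)⁻¹)) := by
  have h1 := norm_inv_one_sub_le ((norm_mul_pow_le hp y n).trans hy) hx
  have h2 := norm_inv_one_sub_pow_succ_le hp n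
  have h3 := norm_pow_le_one hp (n * (n + 1))
  have h4 := norm_pow_le_one hp ((n + 1) * (n + 1))
  calc _ ≤ 1 * ‖y‖ ^ (n + 1) * (1 - ‖x‖)⁻¹ + 1 * ‖y‖ ^ (n + 1) * (1 - ‖p‖)⁻¹ := by
        refine (norm_add_le _ _).trans ?_
        rw [div_eq_mul_inv, norm_mul, norm_mul, div_eq_mul_inv, norm_mul, norm_mul, norm_pow y]
        gcongr
    _ = ‖y‖ * (‖y‖ ^ n * ((1 - ‖x‖)⁻¹ + (1 - ‖p‖)⁻¹)) := by ring
    _ ≤ _ := by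
        have : (0 : ℝ) < (1 - ‖p‖)⁻¹ := inv_pos.2 (by linarith)
        have : (0 : ℝ) < (1 - ‖x‖)⁻¹ := inv_pos.2 (by linarith)
        gcongr

/-- In the double series ∑ x^m p^(m i) over m ≥ 1, i ≥ 0, the n-th term collects the hook with
corner (m, i) = (n + 1, n). The proof telescopes instead, the certificate being the first of the two
fractions, i.e. the arm i = n. -/
lemma hasSum_durfee (hp : ‖p‖ < 1) {x : ℂ} (hx : ‖x‖ < 1) :
    HasSum (fun n : ℕ => p ^ (n * (n + 1)) * x ^ (n + 1) / (1 - x * p ^ n) +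
        p ^ ((n + 1) * (n + 1)) * x ^ (n + 1) / (1 - p ^ (n + 1))) (lambertSeries x p) := by
  have hb := (summable_geometric_of_lt_one (norm_nonneg x) hx).mul_right
    ((1 - ‖x‖)⁻¹ + (1 - ‖p‖)⁻¹)
  have hs := Summable.of_norm_bounded (hb.mul_left ‖x‖) (norm_durfee_term_le hp hx le_rfl)
  rw [tendsto_nhds_unique (tendsto_sum_lambertSeries hp hx)
    (tendsto_sum_of_pDifference hp (u := fun y n => p ^ (n * (n + 1)) * y ^ (n + 1) /
        (1 - y * p ^ n) + p ^ ((n + 1) * (n + 1)) * y ^ (n + 1) / (1 - p ^ (n + 1)))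
    (A := fun y n => p ^ (n * (n + 1)) * y ^ (n + 1) / (1 - y * p ^ n))
    hb (fun y hy n => norm_durfee_term_le hp hx hy n) (fun y hy => ?_)
    (fun y _ => by simp) (fun y hy n => ?_))]
  · exact hs.hasSum
  · refine tendsto_zero_of_norm_le_mul_pow (norm_nonneg y) (hy.trans_lt hx)
      (C := ‖y‖ * (1 - ‖x‖)⁻¹) fun n => ?_
    have h1 := norm_inv_one_sub_le ((norm_mul_pow_le hp y n).trans hy) hx
    have h3 := norm_pow_le_one hp (n * (n + 1))
    calc _ ≤ 1 * ‖y‖ ^ (n + 1) * (1 - ‖x‖)⁻¹ := by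
          rw [div_eq_mul_inv, norm_mul, norm_mul, norm_pow y]
          gcongr
      _ = _ := by ring
  · have h1 := one_sub_pow_succ_ne_zero hp n
    have h2 := one_sub_mul_pow_ne_zero hp (hy.trans_lt hx)
    have h5 := h2 n
    have h6 := h2 (n + 1)
    have e1 : y * p * p ^ n = y * p ^ (n + 1) := by ring
    have e2 : p ^ ((n + 1) * (n + 1)) = p ^ (n * (n + 1)) * p ^ (n + 1) := by ring
    have e3 : p ^ ((n + 1) * (n + 1 + 1)) = p ^ (n * (n + 1)) * p ^ (n + 1) * p ^ (n + 1) := by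
      ring
    rw [e1, e2, e3, mul_pow, pow_succ y (n + 1)]
    generalize p ^ (n + 1) = P at *
    generalize p ^ (n * (n + 1)) = R at *
    generalize p ^ n = S at *
    generalize y ^ (n + 1) = Y at *
    field_simp
    ring

end LambertSeries

/-! ### A ₁φ₁ summation and the Bailey transform for convergent series. -/

section BaileyTransform

variable {p : ℂ}

/-- The general term of the basic hypergeometric series `₁φ₁(a; a y; p, y)`. -/
noncomputable def phiTerm (p a y : ℂ) (k : ℕ) : ℂ :=
  qPoch a p k * (-1) ^ k * p ^ (k.choose 2) * y ^ k / (qPoch p p k * qPoch (a * y) p k)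

/-- The constant is uniform in a and y. This serves both the limit y p^n → 0 and the tail estimate
below, where a and y depend on j. -/
lemma exists_norm_phiTerm_le (hp : ‖p‖ < 1) {ρ : ℝ} (hρ : ρ < 1) :
    ∃ C : ℝ, 0 ≤ C ∧ ∀ a y : ℂ, ‖a‖ ≤ 1 → ‖y‖ ≤ ρ → ∀ k, ‖phiTerm p a y k‖ ≤ C * ‖y‖ ^ k := by
  have h1 : (0 : ℝ) < 1 - ‖p‖ := by linarith
  refine ⟨Real.exp (1 / (1 - ‖p‖)) * (Real.exp ((1 - ‖p‖)⁻¹ * ‖p‖ / (1 - ‖p‖)) *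
    Real.exp ((1 - ρ)⁻¹ * ρ / (1 - ‖p‖))), by positivity, fun a y ha hy k => ?_⟩
  have hay : ‖a * y‖ ≤ ρ := by
    rw [norm_mul]
    exact (mul_le_of_le_one_left (norm_nonneg y) ha).trans hy
  have e1 : ‖qPoch a p k‖ ≤ Real.exp (1 / (1 - ‖p‖)) :=
    (norm_qPoch_le hp a k).trans (Real.exp_le_exp.2 (by gcongr))
  have e2 := norm_qPoch_inv_le_of_norm_le hp (le_refl ‖p‖) hp k
  have e3 := norm_qPoch_inv_le_of_norm_le hp hay hρ k
  have e4 := norm_pow_le_one hp (k.choose 2)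
  calc ‖phiTerm p a y k‖ = ‖qPoch a p k‖ * ‖p ^ k.choose 2‖ * ‖y‖ ^ k *
        (‖(qPoch p p k)⁻¹‖ * ‖(qPoch (a * y) p k)⁻¹‖) := by
        simp [phiTerm, div_eq_mul_inv, mul_comm]
    _ ≤ Real.exp (1 / (1 - ‖p‖)) * 1 * ‖y‖ ^ k * (Real.exp ((1 - ‖p‖)⁻¹ * ‖p‖ / (1 - ‖p‖)) *
        Real.exp ((1 - ρ)⁻¹ * ρ / (1 - ‖p‖))) := by gcongr
    _ = _ := by ring

lemma summable_phiTerm (hp : ‖p‖ < 1) {a y : ℂ} (ha : ‖a‖ ≤ 1) (hy : ‖y‖ < 1) :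
    Summable (phiTerm p a y) := by
  obtain ⟨C, -, hC⟩ := exists_norm_phiTerm_le hp hy
  exact Summable.of_norm_bounded ((summable_geometric_of_lt_one (norm_nonneg y) hy).mul_left C)
    (hC a y ha le_rfl)

lemma norm_mul_lt_one_of_le {a y : ℂ} (ha : ‖a‖ ≤ 1) (hy : ‖y‖ < 1) : ‖a * y‖ < 1 := by
  rw [norm_mul]
  exact (mul_le_of_le_one_left (norm_nonneg y) ha).trans_lt hy

lemma tsum_phiTerm_pDifference (hp : ‖p‖ < 1) {a y : ℂ} (ha : ‖a‖ ≤ 1) (hy : ‖y‖ < 1) :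
    (1 - a * y) * ∑' k, phiTerm p a y k = (1 - y) * ∑' k, phiTerm p a (y * p) k := by
  have hyp : ‖y * p‖ < 1 := by simpa using (norm_mul_pow_le hp y 1).trans_lt hy
  have s1 := summable_phiTerm hp ha hy
  have s2 := summable_phiTerm hp ha hyp
  have hay := norm_mul_lt_one_of_le ha hy
  rw [← sub_eq_zero, ← tsum_mul_left, ← tsum_mul_left,
    ← (s1.mul_left _).tsum_sub (s2.mul_left _)]
  -- The difference of the two sides telescopes; the factor 1 - p^k makes the certificate vanish at
  -- k = 0, so the total is 0.
  rw [tsum_eq_of_telescoping (A := fun k => (1 - a * y) * ((1 - p ^ k) * phiTerm p a y k))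
    ((s1.mul_left _).sub (s2.mul_left _)) (fun k => ?_) ?_]
  · simp
  · have := s1.tendsto_atTop_zero
    have h2 := ((tendsto_pow_atTop_nhds_zero_of_norm_lt_one hp).const_sub 1).mul this
    simpa using h2.const_mul (1 - a * y)
  · have h1 := one_sub_pow_succ_ne_zero hp k
    have h2 := one_sub_mul_pow_ne_zero hp hay
    have h3 := qPoch_ne_zero h2 k
    have h4 : 1 - a * y ≠ 0 := by simpa using h2 0
    have h5 := h2 k
    have h6 : qPoch p p k ≠ 0 := qPoch_ne_zero (one_sub_mul_pow_ne_zero hp hp) k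
    have h7 : qPoch (a * (y * p)) p k = qPoch (a * y) p k * (1 - a * y * p ^ k) / (1 - a * y) := by
      rw [← qPoch_succ, qPoch_succ_left (a * y), mul_assoc, mul_div_cancel_left₀ _ h4]
    have h8 : 1 - p * p ^ k ≠ 0 := by rwa [pow_succ'] at h1
    simp only [phiTerm]
    rw [h7, qPoch_succ, qPoch_succ, qPoch_succ, mul_pow, Nat.choose_succ_succ' k 1,
      Nat.choose_one_right, pow_add p k (k.choose 2), pow_succ' y k, pow_succ' (-1 : ℂ) k,
      pow_succ' p k]
    generalize p ^ k = P at *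
    generalize p ^ (k.choose 2) = R at *
    generalize y ^ k = Y at *
    generalize (-1 : ℂ) ^ k = s at *
    generalize qPoch a p k = Q1 at *
    generalize qPoch p p k = Q2 at *
    generalize qPoch (a * y) p k = Q3 at *
    have h9 : 1 - P * p ≠ 0 := by rwa [mul_comm]
    have h10 : 1 - P * (a * y) ≠ 0 := by rwa [mul_comm]
    have h11 : 1 - y * a ≠ 0 := by rwa [mul_comm]
    have h12 : 1 - P * a * y ≠ 0 := by rwa [mul_assoc]
    field_simp
    ring

lemma tendsto_tsum_phiTerm (hp : ‖p‖ < 1) {a y : ℂ} (ha : ‖a‖ ≤ 1) (hy : ‖y‖ < 1) :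
    Tendsto (fun n : ℕ => ∑' k, phiTerm p a (y * p ^ n) k) atTop (𝓝 1) := by
  obtain ⟨C, hC0, hC⟩ := exists_norm_phiTerm_le hp hy
  have hk : ∀ k, ‖y * p ^ k‖ ≤ ‖y‖ := norm_mul_pow_le hp y
  rw [← tsum_ite_eq (0 : ℕ) (fun _ => (1 : ℂ))]
  refine tendsto_tsum_of_dominated_convergence (bound := fun k => C * ‖y‖ ^ k)
    ((summable_geometric_of_lt_one (norm_nonneg y) hy).mul_left C) (fun k => ?_)
    (Eventually.of_forall fun n k => ?_)
  · rcases Nat.eq_zero_or_pos k with rfl | hk0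
    · simp [phiTerm]
    · rw [if_neg hk0.ne']
      refine squeeze_zero_norm (fun n => hC a _ ha (hk n) k) ?_
      have := ((tendsto_mul_pow_zero hp y).norm.pow k).const_mul C
      simpa [hk0.ne'] using this
  · exact (hC a _ ha (hk n) k).trans (by gcongr; exact hk n)

lemma tendsto_qPoch_mul_pow (hp : ‖p‖ < 1) (y : ℂ) (j : ℕ) :
    Tendsto (fun n : ℕ => qPoch (y * p ^ n) p j) atTop (𝓝 1) := by
  have : Tendsto (fun n : ℕ => qPoch (y * p ^ n) p j) atTop
      (𝓝 (∏ i ∈ Finset.range j, (1 - 0 * p ^ i))) :=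
    tendsto_finsetProd _ fun i _ => ((tendsto_mul_pow_zero hp y).mul_const _).const_sub 1
  simpa using this

/-- The summation `₁φ₁(p^j; y p^j; p, y) = (y; p)_j`. -/
lemma tsum_phiTerm (hp : ‖p‖ < 1) {y : ℂ} (hy : ‖y‖ < 1) (j : ℕ) :
    ∑' k, phiTerm p (p ^ j) y k = qPoch y p j := by
  have ha := norm_pow_le_one hp j
  have hk : ∀ k, ‖y * p ^ k‖ ≤ ‖y‖ := norm_mul_pow_le hp y
  have hay := norm_mul_lt_one_of_le ha hy
  -- The series and the product (y; p)_j obey the same first-order p-difference equation (`key` and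
  -- `key2`), and both tend to 1 along y p^n. Hence their difference is a bounded factor times a
  -- null sequence.
  have key : ∀ n, qPoch (p ^ j * y) p n * ∑' k, phiTerm p (p ^ j) y k =
      qPoch y p n * ∑' k, phiTerm p (p ^ j) (y * p ^ n) k := by
    intro n
    induction n with
    | zero => simp
    | succ n ih =>
      have h := tsum_phiTerm_pDifference hp ha ((hk n).trans_lt hy)
      rw [mul_assoc y, ← pow_succ, ← mul_assoc] at h
      rw [qPoch_succ, qPoch_succ, mul_right_comm, ih, mul_right_comm, mul_assoc,
        mul_assoc (qPoch y p n), ← h]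
  have key2 : ∀ n, qPoch (p ^ j * y) p n * qPoch y p j = qPoch y p n * qPoch (y * p ^ n) p j := by
    intro n
    rw [mul_comm (p ^ j), mul_comm, ← qPoch_add, ← qPoch_add, add_comm]
  obtain ⟨C, hC⟩ := exists_norm_qPoch_inv_le hp (one_sub_mul_pow_ne_zero hp hay)
  have hlim := ((tendsto_tsum_phiTerm hp ha hy).sub (tendsto_qPoch_mul_pow hp y j)).norm.const_mul
    (C * Real.exp (‖y‖ / (1 - ‖p‖)))
  rw [sub_self, norm_zero, mul_zero] at hlim
  have hle := ge_of_tendsto' (b := ‖∑' k, phiTerm p (p ^ j) y k - qPoch y p j‖) hlim fun n => by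
    have h0 := qPoch_ne_zero (one_sub_mul_pow_ne_zero hp hay) n
    have e : ∑' k, phiTerm p (p ^ j) y k - qPoch y p j = (qPoch (p ^ j * y) p n)⁻¹ *
        qPoch y p n * (∑' k, phiTerm p (p ^ j) (y * p ^ n) k - qPoch (y * p ^ n) p j) := by
      rw [mul_assoc, mul_sub, ← key, ← key2, ← mul_sub, inv_mul_cancel_left₀ h0]
    rw [e, norm_mul, norm_mul]
    have h1 := hC n
    have h2 := norm_qPoch_le hp y n
    have h3 : 0 ≤ C := (norm_nonneg _).trans (hC n)
    gcongr
  exact sub_eq_zero.1 (norm_le_zero_iff.1 hle)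

lemma add_choose_two (m k : ℕ) : (m + k).choose 2 = m.choose 2 + k.choose 2 + m * k := by
  induction k with
  | zero => simp
  | succ k ih =>
    rw [← add_assoc, Nat.choose_succ_succ' (m + k) 1, Nat.choose_succ_succ' k 1,
      Nat.choose_one_right, Nat.choose_one_right, ih]
    ring

/-- The conjugate Bailey weight `(p; p)_n (-1)^(n+1) p^(n(n+1)/2) x^(n+1)`. -/
noncomputable def baileyWeight (x p : ℂ) (n : ℕ) : ℂ :=
  qPoch p p n * (-1) ^ (n + 1) * p ^ ((n + 1).choose 2) * x ^ (n + 1)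

/-- With n = j + k, split (x; p)_{2j+2+k} into blocks of lengths j + 1, j + 1 and k. The coefficient
of α_{j+1} in the term with β_{n+1} becomes its final weight times a ₁φ₁ term normalised by its sum.
-/
lemma baileyWeight_add_div (hp : ‖p‖ < 1) {x : ℂ} (hx : ‖x‖ < 1) (j k : ℕ) :
    baileyWeight x p (j + k) / (qPoch p p k * qPoch x p (j + k + 1 + (j + 1))) =
      baileyWeight x p j / qPoch x p (j + 1) *
        (phiTerm p (p ^ (j + 1)) (x * p ^ (j + 1)) k / qPoch (x * p ^ (j + 1)) p (j + 1)) := by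
  have h1 := qPoch_ne_zero (one_sub_mul_pow_ne_zero hp hx) (j + 1 + (j + 1) + k)
  have e1 : j + k + 1 + (j + 1) = j + 1 + (j + 1) + k := by ring
  rw [e1]
  rw [qPoch_add, qPoch_add] at h1 ⊢
  have h2 : qPoch p p k ≠ 0 := qPoch_ne_zero (one_sub_mul_pow_ne_zero hp hp) k
  have e2 : p ^ (j + 1) * (x * p ^ (j + 1)) = x * p ^ (j + 1 + (j + 1)) := by ring
  have e3 : j + k + 1 = j + 1 + k := by ring
  simp only [baileyWeight, phiTerm, e2]
  rw [qPoch_add p p j k, ← pow_succ', e3, add_choose_two, mul_pow, pow_add p _ ((j + 1) * k),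
    pow_add p _ (k.choose 2), pow_add x, pow_add (-1 : ℂ) (j + 1), pow_mul]
  have h3 := left_ne_zero_of_mul (left_ne_zero_of_mul h1)
  have h4 := right_ne_zero_of_mul (left_ne_zero_of_mul h1)
  have h5 := right_ne_zero_of_mul h1
  field_simp

/-- The normalised ₁φ₁ series sums to 1, so the defect is a tail. The bound C ‖p‖^N does not depend
on j, which is what conditional convergence requires. -/
lemma norm_tail_phiTerm_le (hp : ‖p‖ < 1) {x : ℂ} (hx : ‖x‖ < 1) :
    ∃ C : ℝ, 0 ≤ C ∧ ∀ j N : ℕ, j < N →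
      ‖(∑ k ∈ Finset.range (N - j), phiTerm p (p ^ (j + 1)) (x * p ^ (j + 1)) k /
        qPoch (x * p ^ (j + 1)) p (j + 1)) - 1‖ ≤ C * ‖p‖ ^ N := by
  obtain ⟨C, hC0, hC⟩ := exists_norm_phiTerm_le hp hx
  have hp1 : (0 : ℝ) < 1 - ‖p‖ := by linarith
  refine ⟨C * (1 - ‖p‖)⁻¹ * Real.exp ((1 - ‖x‖)⁻¹ * ‖x‖ / (1 - ‖p‖)), by positivity,
    fun j N hj => ?_⟩
  have hk : ‖x * p ^ (j + 1)‖ ≤ ‖x‖ := norm_mul_pow_le hp x _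
  have ha := norm_pow_le_one hp (j + 1)
  have hsum := (summable_phiTerm hp ha (hk.trans_lt hx)).sum_add_tsum_nat_add (N - j)
  rw [tsum_phiTerm hp (hk.trans_lt hx)] at hsum
  have h0 := qPoch_ne_zero (one_sub_mul_pow_ne_zero hp (hk.trans_lt hx)) (j + 1)
  have e : (∑ k ∈ Finset.range (N - j), phiTerm p (p ^ (j + 1)) (x * p ^ (j + 1)) k /
        qPoch (x * p ^ (j + 1)) p (j + 1)) - 1 =
      -((∑' k, phiTerm p (p ^ (j + 1)) (x * p ^ (j + 1)) (k + (N - j))) *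
        (qPoch (x * p ^ (j + 1)) p (j + 1))⁻¹) := by
    rw [← Finset.sum_div, eq_sub_of_add_eq hsum]
    field_simp
    ring
  rw [e, norm_neg, norm_mul]
  have hb : HasSum (fun k : ℕ => C * ‖p‖ ^ N * ‖p‖ ^ k) (C * ‖p‖ ^ N * (1 - ‖p‖)⁻¹) :=
    (hasSum_geometric_of_lt_one (norm_nonneg p) hp).mul_left _
  have h1 := tsum_of_norm_bounded hb
    (f := fun k => phiTerm p (p ^ (j + 1)) (x * p ^ (j + 1)) (k + (N - j))) fun k => by
      refine (hC _ _ ha hk _).trans ?_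
      rw [mul_assoc, ← pow_add]
      gcongr
      obtain ⟨m, rfl⟩ := Nat.exists_eq_add_of_lt hj
      have e4 : j + m + 1 - j = m + 1 := by omega
      calc ‖x * p ^ (j + 1)‖ ^ (k + (j + m + 1 - j)) ≤ (‖p‖ ^ (j + 1)) ^ (k + (m + 1)) := by
            rw [norm_mul, norm_pow, e4]
            gcongr
            exact mul_le_of_le_one_left (by positivity) hx.le
        _ = ‖p‖ ^ ((j + 1) * (k + (m + 1))) := by rw [pow_mul]
        -- Here N = j + m + 1, and (j + 1)(k + m + 1) = N + k + j (k + m).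
        _ ≤ ‖p‖ ^ (j + m + 1 + k) :=
            pow_le_pow_of_le_one (norm_nonneg p) hp.le (by nlinarith [Nat.zero_le (j * (k + m))])
  have h2 := norm_qPoch_inv_le_of_norm_le hp hk hx (j + 1)
  calc _ ≤ (C * ‖p‖ ^ N * (1 - ‖p‖)⁻¹) * Real.exp ((1 - ‖x‖)⁻¹ * ‖x‖ / (1 - ‖p‖)) := by gcongr
    _ = _ := by ring

/-- Inserting the truncated `₁φ₁` sums into a convergent, possibly only conditionally convergent,
series does not change its sum. -/
lemma tendsto_sum_mul_phi (hp : ‖p‖ < 1) {x A : ℂ} (hx : ‖x‖ < 1) {T : ℕ → ℂ}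
    (hT : Tendsto (fun N => ∑ j ∈ Finset.range N, T j) atTop (𝓝 A)) :
    Tendsto (fun N => ∑ j ∈ Finset.range N, T j * ∑ k ∈ Finset.range (N - j),
      phiTerm p (p ^ (j + 1)) (x * p ^ (j + 1)) k / qPoch (x * p ^ (j + 1)) p (j + 1))
      atTop (𝓝 A) := by
  obtain ⟨C, hC0, hC⟩ := norm_tail_phiTerm_le hp hx
  have hT0 : Tendsto T atTop (𝓝 0) := by
    have := (hT.comp (tendsto_add_atTop_nat 1)).sub hT
    simpa [Finset.sum_range_succ, Function.comp_def] using this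
  obtain ⟨M, hM⟩ := hT0.norm.bddAbove_range
  have hM' : ∀ j, ‖T j‖ ≤ M := fun j => hM ⟨j, rfl⟩
  have hM0 : 0 ≤ M := (norm_nonneg _).trans (hM' 0)
  -- The terms T_j are bounded by some M, so replacing every truncated inner sum by 1 costs at most
  -- M C N ‖p‖^N, which tends to 0.
  rw [← add_zero A]
  refine (hT.add (squeeze_zero_norm (f := fun N => ∑ j ∈ Finset.range N, T j *
    ((∑ k ∈ Finset.range (N - j), phiTerm p (p ^ (j + 1)) (x * p ^ (j + 1)) k /
      qPoch (x * p ^ (j + 1)) p (j + 1)) - 1))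
    (a := fun N => M * C * (N * ‖p‖ ^ N)) (fun N => ?_) ?_)).congr fun N => ?_
  · refine (norm_sum_le _ _).trans ?_
    calc _ ≤ ∑ _j ∈ Finset.range N, M * (C * ‖p‖ ^ N) := by
          refine Finset.sum_le_sum fun j hj => ?_
          rw [norm_mul]
          have h1 := hC j N (Finset.mem_range.1 hj)
          have h2 := hM' j
          gcongr
      _ = _ := by
          rw [Finset.sum_const, Finset.card_range, nsmul_eq_mul]
          ring
  · simpa using (tendsto_self_mul_const_pow_of_lt_one (norm_nonneg p) hp).const_mul (M * C)
  · rw [← Finset.sum_add_distrib]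
    exact Finset.sum_congr rfl fun j _ => by ring

/-- Only convergence of partial sums is assumed for the α-series. The index j = 0 gives the Lambert
series through its alternating expansion; the indices j ≥ 1 give A through the ₁φ₁ summation. -/
theorem tendsto_baileyTransform (hp : ‖p‖ < 1) {x A : ℂ} (hx : ‖x‖ < 1) {α β : ℕ → ℂ}
    (hα : α 0 = 1)
    (hβ : ∀ n : ℕ, 0 < n → β n = ∑ j ∈ Finset.range (n + 1),
      1 / (qPoch p p (n - j) * qPoch x p (n + j)) * α j)
    (hA : Tendsto (fun N => ∑ n ∈ Finset.range N,
      baileyWeight x p n * α (n + 1) / qPoch x p (n + 1)) atTop (𝓝 A)) :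
    Tendsto (fun N => ∑ n ∈ Finset.range N, baileyWeight x p n * β (n + 1)) atTop
      (𝓝 (A - lambertSeries x p)) := by
  have h1 := (tendsto_sum_mul_phi hp hx hA).sub (hasSum_alternating hp hx).tendsto_sum_nat
  refine h1.congr fun N => ?_
  have e : ∀ n, baileyWeight x p n * β (n + 1) =
      (∑ j ∈ Finset.range (n + 1), baileyWeight x p n * α (j + 1) /
        (qPoch p p (n - j) * qPoch x p (n + 1 + (j + 1)))) -
      (-1) ^ n * p ^ ((n + 1).choose 2) * x ^ (n + 1) /
        (qPoch x p (n + 1) * (1 - p ^ (n + 1))) := by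
    intro n
    have h2 := qPoch_ne_zero (one_sub_mul_pow_ne_zero hp hx) (n + 1)
    have h3 : qPoch p p n ≠ 0 := qPoch_ne_zero (one_sub_mul_pow_ne_zero hp hp) n
    have h4 := one_sub_pow_succ_ne_zero hp n
    rw [hβ _ n.succ_pos, Finset.sum_range_succ', mul_add, hα, sub_eq_add_neg, Finset.mul_sum]
    congr 1
    · refine Finset.sum_congr rfl fun j _ => ?_
      rw [Nat.succ_eq_add_one, Nat.add_sub_add_right]
      ring
    · rw [Nat.sub_zero, add_zero, qPoch_succ p p n, baileyWeight, ← pow_succ']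
      field_simp
      ring
  simp only [e]
  rw [Finset.sum_sub_distrib]
  congr 1
  -- The exchange takes place over the finite triangle j ≤ n < N; afterwards n = j + k with k < N -
  -- j.
  rw [Finset.sum_comm' (t' := Finset.range N) (s' := fun j => Finset.Ico j N)
    (fun n j => by simp only [Finset.mem_range, Finset.mem_Ico]; omega)]
  refine Finset.sum_congr rfl fun j _ => ?_
  rw [Finset.sum_Ico_eq_sum_range, Finset.mul_sum]
  refine Finset.sum_congr rfl fun k _ => ?_
  calc _ = α (j + 1) * (baileyWeight x p j / qPoch x p (j + 1) *
        (phiTerm p (p ^ (j + 1)) (x * p ^ (j + 1)) k / qPoch (x * p ^ (j + 1)) p (j + 1))) := by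
        ring
    _ = _ := by
        rw [← baileyWeight_add_div hp hx, Nat.add_sub_cancel_left]
        ring

end BaileyTransform

/-! ### The two-parameter Bailey pair via a terminating ₆φ₅ sum. -/

section WellPoised

variable {p : ℂ}

/-- The sequence `α_n` of the two-parameter Bailey pair relative to `a`. -/
noncomputable def wellPoisedAlpha (c d a p : ℂ) (n : ℕ) : ℂ :=
  qPoch a p n * qPoch c p n * qPoch d p n * (1 - a * p ^ (2 * n)) * (-1) ^ n *
    p ^ (n.choose 2) * (a * p / (c * d)) ^ n /
    ((1 - a) * (qPoch p p n * qPoch (a * p / c) p n * qPoch (a * p / d) p n))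

/-- The sequence `β_n` of the two-parameter Bailey pair relative to `a`. -/
noncomputable def wellPoisedBeta (c d a p : ℂ) (n : ℕ) : ℂ :=
  qPoch (a * p / (c * d)) p n / (qPoch p p n * qPoch (a * p / c) p n * qPoch (a * p / d) p n)

/-- The telescoping certificate for the recurrence in `n` of the terminating sum. -/
noncomputable def wellPoisedCert (c d a p : ℂ) (n j : ℕ) : ℂ :=
  p ^ (n + 1 - j) * wellPoisedAlpha c d a p j * (1 - p ^ j) * (1 - a * p ^ j / c) *
    (1 - a * p ^ j / d) / ((1 - a * p ^ (2 * j)) * qPoch p p (n + 1 - j) * qPoch (a * p) p (n + j))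

variable {a c d : ℂ}

lemma wellPoisedCert_telescope (hp : ‖p‖ < 1) (hc : c ≠ 0) (hd : d ≠ 0)
    (ha : ∀ j, 1 - a * p ^ j ≠ 0) (hac : ∀ j, 1 - a * p / c * p ^ j ≠ 0)
    (had : ∀ j, 1 - a * p / d * p ^ j ≠ 0) (j m : ℕ) :
    (1 - p ^ (j + m + 1)) * (1 - a * p ^ (j + m + 1) / c) * (1 - a * p ^ (j + m + 1) / d) *
        (1 / (qPoch p p (m + 1) * qPoch (a * p) p (j + m + 1 + j)) * wellPoisedAlpha c d a p j) -
      (1 - a * p ^ (j + m + 1) / (c * d)) *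
        (1 / (qPoch p p m * qPoch (a * p) p (j + m + j)) * wellPoisedAlpha c d a p j) =
      wellPoisedCert c d a p (j + m) j - wellPoisedCert c d a p (j + m) (j + 1) := by
  have e1 : j + m + 1 - j = m + 1 := by omega
  have e2 : j + m + 1 - (j + 1) = m := by omega
  have e3 : j + m + 1 + j = j + m + j + 1 := by ring
  have e4 : j + m + (j + 1) = j + m + j + 1 := by ring
  have ha0 : 1 - a ≠ 0 := by simpa using ha 0
  have ha1 : ∀ i, 1 - a * p * p ^ i ≠ 0 := fun i => by
    rw [mul_assoc, ← pow_succ']; exact ha _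
  have hpp : ∀ i, 1 - p * p ^ i ≠ 0 := one_sub_mul_pow_ne_zero hp hp
  have h1 := qPoch_ne_zero hpp m
  have h2 := qPoch_ne_zero hpp j
  have h3 := qPoch_ne_zero hac j
  have h4 := qPoch_ne_zero had j
  have h5 := qPoch_ne_zero ha1 (j + m + j)
  have h6 := ha (2 * j)
  have h7 := ha (2 * (j + 1))
  have h8 := hpp m
  have h9 := hpp j
  have h10 := hac j
  have h11 := had j
  have h12 := ha1 (j + m + j)
  simp only [wellPoisedCert, wellPoisedAlpha, e1, e2, e3, e4]
  rw [qPoch_succ p p m, qPoch_succ p p j, qPoch_succ _ _ (j + m + j), qPoch_succ a, qPoch_succ c,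
    qPoch_succ d, qPoch_succ (a * p / c), qPoch_succ (a * p / d), Nat.choose_succ_succ' j 1,
      Nat.choose_one_right, pow_add p j (j.choose 2), pow_succ (-1 : ℂ) j,
      pow_succ (a * p / (c * d)) j]
  have k1 : p ^ (2 * j) = p ^ j * p ^ j := by ring
  have k2 : p ^ (2 * (j + 1)) = p ^ j * p ^ j * p * p := by ring
  have k3 : p ^ (j + m + 1) = p ^ j * p ^ m * p := by ring
  have k4 : p ^ (j + m + j) = p ^ j * p ^ m * p ^ j := by ring
  rw [k1] at h6
  rw [k2] at h7
  rw [k4] at h12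
  rw [k1, k2, k3, k4, pow_succ p j, pow_succ p m]
  generalize qPoch p p m = Q1 at *
  generalize qPoch p p j = Q2 at *
  generalize qPoch (a * p / c) p j = Q3 at *
  generalize qPoch (a * p / d) p j = Q4 at *
  generalize qPoch (a * p) p (j + m + j) = Q5 at *
  generalize qPoch a p j = Q6 at *
  generalize qPoch c p j = Q7 at *
  generalize qPoch d p j = Q8 at *
  generalize p ^ (j.choose 2) = R at *
  generalize (a * p / (c * d)) ^ j = V at *
  generalize (-1 : ℂ) ^ j = s at *
  generalize p ^ j = J at *
  generalize p ^ m = M at *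
  have h10' : c - a * p * J ≠ 0 := by
    intro h; apply h10; field_simp; linear_combination h
  have h11' : d - a * p * J ≠ 0 := by
    intro h; apply h11; field_simp; linear_combination h
  have g1 : 1 - a * p / c * J = (c - a * p * J) / c := by field_simp
  have g2 : 1 - a * p / d * J = (d - a * p * J) / d := by field_simp
  have g3 : 1 - a * (J * p) / c = (c - a * p * J) / c := by field_simp
  have g4 : 1 - a * (J * p) / d = (d - a * p * J) / d := by field_simp
  rw [g1, g2, g3, g4]
  have g5 : 1 - J * p ≠ 0 := by rwa [mul_comm]
  rw [mul_comm p J]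
  rw [mul_comm p M] at *
  generalize hD1 : c - a * p * J = D1 at *
  generalize hD2 : d - a * p * J = D2 at *
  generalize hD3 : 1 - J * p = D3 at *
  generalize hD4 : 1 - M * p = D4 at *
  generalize hD5 : 1 - a * (J * J) = D5 at *
  generalize hD6 : 1 - a * (J * J * p * p) = D6 at *
  generalize hD7 : 1 - a * p * (J * M * J) = D7 at *
  field_simp
  subst hD4 hD7 hD5
  ring

/-- Both sides satisfy the same first-order recurrence in n. For the sum, applying the recurrence to
the summand gives a difference in j of `wellPoisedCert`. -/
lemma sum_wellPoisedAlpha (hp : ‖p‖ < 1) (hc : c ≠ 0) (hd : d ≠ 0)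
    (ha : ∀ j, 1 - a * p ^ j ≠ 0) (hac : ∀ j, 1 - a * p / c * p ^ j ≠ 0)
    (had : ∀ j, 1 - a * p / d * p ^ j ≠ 0) (n : ℕ) :
    ∑ j ∈ Finset.range (n + 1),
      1 / (qPoch p p (n - j) * qPoch (a * p) p (n + j)) * wellPoisedAlpha c d a p j =
      wellPoisedBeta c d a p n := by
  have ha0 : 1 - a ≠ 0 := by simpa using ha 0
  induction n with
  | zero => simp [wellPoisedAlpha, wellPoisedBeta, ha0]
  | succ n ih =>
    have hpp : ∀ i, 1 - p * p ^ i ≠ 0 := one_sub_mul_pow_ne_zero hp hp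
    have ha1 : ∀ i, 1 - a * p * p ^ i ≠ 0 := fun i => by
      rw [mul_assoc, ← pow_succ']; exact ha _
    have h1 : 1 - p ^ (n + 1) ≠ 0 := one_sub_pow_succ_ne_zero hp n
    have ec : a * p / c * p ^ n = a * p ^ (n + 1) / c := by ring
    have ed : a * p / d * p ^ n = a * p ^ (n + 1) / d := by ring
    have ecd : a * p / (c * d) * p ^ n = a * p ^ (n + 1) / (c * d) := by ring
    have h2 : 1 - a * p ^ (n + 1) / c ≠ 0 := ec ▸ hac n
    have h3 : 1 - a * p ^ (n + 1) / d ≠ 0 := ed ▸ had n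
    have hD := mul_ne_zero (mul_ne_zero h1 h2) h3
    have hsum : ∑ j ∈ Finset.range (n + 1),
        ((1 - p ^ (n + 1)) * (1 - a * p ^ (n + 1) / c) * (1 - a * p ^ (n + 1) / d) *
          (1 / (qPoch p p (n + 1 - j) * qPoch (a * p) p (n + 1 + j)) *
            wellPoisedAlpha c d a p j) -
        (1 - a * p ^ (n + 1) / (c * d)) *
          (1 / (qPoch p p (n - j) * qPoch (a * p) p (n + j)) * wellPoisedAlpha c d a p j)) =
        wellPoisedCert c d a p n 0 - wellPoisedCert c d a p n (n + 1) := by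
      rw [← Finset.sum_range_sub']
      refine Finset.sum_congr rfl fun j hj => ?_
      obtain ⟨m, rfl⟩ := Nat.exists_eq_add_of_le (Nat.lt_succ_iff.1 (Finset.mem_range.1 hj))
      rw [← wellPoisedCert_telescope hp hc hd ha hac had, Nat.add_sub_cancel_left,
        show j + m + 1 - j = m + 1 by omega]
    rw [Finset.sum_sub_distrib, ← Finset.mul_sum, ← Finset.mul_sum, ih] at hsum
    have hcert0 : wellPoisedCert c d a p n 0 = 0 := by simp [wellPoisedCert]
    -- The sum for n + 1 has one term more than the sum for n; that term cancels the upper boundary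
    -- value of the certificate, while the lower one vanishes through 1 - p^0.
    have hlast : (1 - p ^ (n + 1)) * (1 - a * p ^ (n + 1) / c) * (1 - a * p ^ (n + 1) / d) *
        (1 / (qPoch p p 0 * qPoch (a * p) p (n + 1 + (n + 1))) *
          wellPoisedAlpha c d a p (n + 1)) = wellPoisedCert c d a p n (n + 1) := by
      have h5 := qPoch_ne_zero ha1 (n + (n + 1))
      have h6 := ha (2 * (n + 1))
      have e1 : n + 1 + (n + 1) = n + (n + 1) + 1 := by ring
      have e2 : 1 - a * p * p ^ (n + (n + 1)) = 1 - a * p ^ (2 * (n + 1)) := by ring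
      rw [wellPoisedCert, e1, qPoch_succ _ _ (n + (n + 1)), e2, Nat.sub_self, pow_zero,
        qPoch_zero]
      generalize 1 - a * p ^ (2 * (n + 1)) = D1 at *
      generalize qPoch (a * p) p (n + (n + 1)) = D2 at *
      field_simp
    rw [Finset.sum_range_succ, Nat.sub_self]
    refine mul_left_cancel₀ hD ?_
    rw [mul_add, hlast, eq_add_of_sub_eq hsum, hcert0, wellPoisedBeta, wellPoisedBeta,
      qPoch_succ, qPoch_succ, qPoch_succ, qPoch_succ, ec, ed, ecd, ← pow_succ']
    have h7 := qPoch_ne_zero hpp n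
    have h8 := qPoch_ne_zero hac n
    have h9 := qPoch_ne_zero had n
    generalize 1 - p ^ (n + 1) = D1 at *
    generalize 1 - a * p ^ (n + 1) / c = D2 at *
    generalize 1 - a * p ^ (n + 1) / d = D3 at *
    generalize 1 - a * p ^ (n + 1) / (c * d) = D4 at *
    generalize qPoch (a * p / c) p n = Q1 at *
    generalize qPoch (a * p / d) p n = Q2 at *
    generalize qPoch (a * p / (c * d)) p n = Q3 at *
    field_simp
    ring

lemma wellPoisedAlpha_zero (h : 1 - a ≠ 0) : wellPoisedAlpha c d a p 0 = 1 := by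
  simp [wellPoisedAlpha, h]

/-- With `x = a p`, the series containing `β_n` converges absolutely. -/
lemma summable_baileyWeight_wellPoisedBeta (hp : ‖p‖ < 1) {x : ℂ} (hx : ‖x‖ < 1)
    (hac : ∀ j, 1 - a * p / c * p ^ j ≠ 0) (had : ∀ j, 1 - a * p / d * p ^ j ≠ 0) :
    Summable fun n => baileyWeight x p n * wellPoisedBeta c d a p (n + 1) := by
  obtain ⟨C1, hC1⟩ := exists_norm_qPoch_inv_le hp hac
  obtain ⟨C2, hC2⟩ := exists_norm_qPoch_inv_le hp had
  have hC10 : 0 ≤ C1 := (norm_nonneg _).trans (hC1 0)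
  have hC20 : 0 ≤ C2 := (norm_nonneg _).trans (hC2 0)
  refine Summable.of_norm_bounded ((summable_geometric_of_lt_one (norm_nonneg x) hx).mul_left
    (Real.exp (‖p‖ / (1 - ‖p‖)) * Real.exp (‖a * p / (c * d)‖ / (1 - ‖p‖)) *
      (Real.exp ((1 - ‖p‖)⁻¹ * ‖p‖ / (1 - ‖p‖)) * C1 * C2))) fun n => ?_
  have e1 := norm_qPoch_le hp p n
  have e2 := norm_qPoch_le hp (a * p / (c * d)) (n + 1)
  have e3 := norm_qPoch_inv_le_of_norm_le hp (le_refl ‖p‖) hp (n + 1)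
  have e4 := hC1 (n + 1)
  have e5 := hC2 (n + 1)
  have e6 := norm_pow_le_one hp ((n + 1).choose 2)
  have e7 : ‖x ^ (n + 1)‖ ≤ ‖x‖ ^ n := by
    rw [norm_pow]
    exact pow_le_pow_of_le_one (norm_nonneg x) hx.le n.le_succ
  calc _ = ‖qPoch p p n‖ * ‖qPoch (a * p / (c * d)) p (n + 1)‖ * (‖(qPoch p p (n + 1))⁻¹‖ *
        ‖(qPoch (a * p / c) p (n + 1))⁻¹‖ * ‖(qPoch (a * p / d) p (n + 1))⁻¹‖) *
        (‖p ^ ((n + 1).choose 2)‖ * ‖x ^ (n + 1)‖) := by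
        simp only [baileyWeight, wellPoisedBeta, div_eq_mul_inv, norm_mul, mul_inv, norm_pow,
          norm_neg, norm_one, one_pow]
        ring
    _ ≤ Real.exp (‖p‖ / (1 - ‖p‖)) * Real.exp (‖a * p / (c * d)‖ / (1 - ‖p‖)) *
        (Real.exp ((1 - ‖p‖)⁻¹ * ‖p‖ / (1 - ‖p‖)) * C1 * C2) * (1 * ‖x‖ ^ n) := by gcongr
    _ = _ := by ring

/-- With `x = a p`, the series containing `α_n` converges absolutely. -/
lemma summable_baileyWeight_wellPoisedAlpha (hp : ‖p‖ < 1) {x : ℂ} (hx : ‖x‖ < 1)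
    (hac : ∀ j, 1 - a * p / c * p ^ j ≠ 0) (had : ∀ j, 1 - a * p / d * p ^ j ≠ 0) :
    Summable fun n => baileyWeight x p n * wellPoisedAlpha c d a p (n + 1) / qPoch x p (n + 1) := by
  obtain ⟨C1, hC1⟩ := exists_norm_qPoch_inv_le hp hac
  obtain ⟨C2, hC2⟩ := exists_norm_qPoch_inv_le hp had
  have hC10 : 0 ≤ C1 := (norm_nonneg _).trans (hC1 0)
  have hC20 : 0 ≤ C2 := (norm_nonneg _).trans (hC2 0)
  -- The weight and α_n each contribute a factor p^(n(n-1)/2). One of them already dominates the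
  -- geometric factor (a p / (c d))^n, whose ratio may be large; the other is bounded by 1.
  have hs := (summable_nat_add_iff 1).2 (summable_pow_choose_two_mul_pow (norm_nonneg p) hp
    ‖a * p / (c * d)‖)
  refine Summable.of_norm_bounded (hs.mul_left
    (Real.exp (‖p‖ / (1 - ‖p‖)) * Real.exp (‖a‖ / (1 - ‖p‖)) * Real.exp (‖c‖ / (1 - ‖p‖)) *
      Real.exp (‖d‖ / (1 - ‖p‖)) * (1 + ‖a‖) * (‖(1 - a)⁻¹‖ *
      Real.exp ((1 - ‖p‖)⁻¹ * ‖p‖ / (1 - ‖p‖)) * C1 * C2 *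
      Real.exp ((1 - ‖x‖)⁻¹ * ‖x‖ / (1 - ‖p‖))))) fun n => ?_
  have e1 := norm_qPoch_le hp p n
  have e2 := norm_qPoch_le hp a (n + 1)
  have e2' := norm_qPoch_le hp c (n + 1)
  have e2'' := norm_qPoch_le hp d (n + 1)
  have e3 := norm_qPoch_inv_le_of_norm_le hp (le_refl ‖p‖) hp (n + 1)
  have e3' := norm_qPoch_inv_le_of_norm_le hp (le_refl ‖x‖) hx (n + 1)
  have e4 := hC1 (n + 1)
  have e5 := hC2 (n + 1)
  have e6 := norm_pow_le_one hp ((n + 1).choose 2)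
  have e7 : ‖x ^ (n + 1)‖ ≤ 1 := norm_pow_le_one hx _
  have e8 : ‖1 - a * p ^ (2 * (n + 1))‖ ≤ 1 + ‖a‖ := by
    refine (norm_sub_le _ _).trans ?_
    rw [norm_one]
    gcongr
    exact norm_mul_pow_le hp a _
  calc _ = ‖qPoch p p n‖ * ‖qPoch a p (n + 1)‖ * ‖qPoch c p (n + 1)‖ * ‖qPoch d p (n + 1)‖ *
        ‖1 - a * p ^ (2 * (n + 1))‖ * (‖(1 - a)⁻¹‖ * ‖(qPoch p p (n + 1))⁻¹‖ *
        ‖(qPoch (a * p / c) p (n + 1))⁻¹‖ * ‖(qPoch (a * p / d) p (n + 1))⁻¹‖ *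
        ‖(qPoch x p (n + 1))⁻¹‖) * ((‖p ^ ((n + 1).choose 2)‖ * ‖x ^ (n + 1)‖) *
        (‖p‖ ^ ((n + 1).choose 2) * ‖a * p / (c * d)‖ ^ (n + 1))) := by
        simp only [baileyWeight, wellPoisedAlpha]
        generalize a * p / (c * d) = V
        generalize a * p / c = V1
        generalize a * p / d = V2
        generalize 1 - a = V3
        generalize 1 - a * p ^ (2 * (n + 1)) = V4
        simp only [div_eq_mul_inv, norm_mul, mul_inv, norm_pow,
          norm_neg, norm_one, one_pow]
        ring
    _ ≤ Real.exp (‖p‖ / (1 - ‖p‖)) * Real.exp (‖a‖ / (1 - ‖p‖)) * Real.exp (‖c‖ / (1 - ‖p‖)) *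
        Real.exp (‖d‖ / (1 - ‖p‖)) * (1 + ‖a‖) * (‖(1 - a)⁻¹‖ *
        Real.exp ((1 - ‖p‖)⁻¹ * ‖p‖ / (1 - ‖p‖)) * C1 * C2 *
        Real.exp ((1 - ‖x‖)⁻¹ * ‖x‖ / (1 - ‖p‖))) * ((1 * 1) *
        (‖p‖ ^ ((n + 1).choose 2) * ‖a * p / (c * d)‖ ^ (n + 1))) := by gcongr
    _ = _ := by ring

/-- The Bailey transform applied to the two-parameter pair. -/
lemma tsum_wellPoised (hp : ‖p‖ < 1) {x : ℂ} (hx : ‖x‖ < 1) (hxa : a * p = x) (hc : c ≠ 0)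
    (hd : d ≠ 0) (ha : ∀ j, 1 - a * p ^ j ≠ 0) (hac : ∀ j, 1 - x / c * p ^ j ≠ 0)
    (had : ∀ j, 1 - x / d * p ^ j ≠ 0) :
    ∃ A B : ℂ, HasSum (fun n => baileyWeight x p n * wellPoisedBeta c d a p (n + 1)) B ∧
      HasSum (fun n => baileyWeight x p n * wellPoisedAlpha c d a p (n + 1) /
        qPoch x p (n + 1)) A ∧ B = A - lambertSeries x p := by
  rw [← hxa] at hac had
  have sA := (summable_baileyWeight_wellPoisedAlpha hp hx hac had).hasSum
  have sB := (summable_baileyWeight_wellPoisedBeta hp hx hac had).hasSum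
  refine ⟨_, _, sB, sA, tendsto_nhds_unique sB.tendsto_sum_nat
    (tendsto_baileyTransform hp hx (wellPoisedAlpha_zero (by simpa using ha 0)) (fun n _ => ?_)
      sA.tendsto_sum_nat)⟩
  rw [← sum_wellPoisedAlpha hp hc hd ha hac had, hxa]

end WellPoised

/-! ### The Jacobi triple product from its finite form. -/

section JacobiTripleProduct

variable {q : ℂ}

/-- The triangular number `k (k - 1) / 2` of an integer `k`. -/
def intTri (k : ℤ) : ℤ := k * (k - 1) / 2

lemma two_mul_intTri (k : ℤ) : 2 * intTri k = k * (k - 1) :=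
  Int.mul_ediv_cancel' (Int.even_mul_pred_self k).two_dvd

lemma intTri_add (i m : ℤ) : intTri (i + m) = intTri i + intTri m + i * m := by
  have h1 := two_mul_intTri (i + m)
  have h2 := two_mul_intTri i
  have h3 := two_mul_intTri m
  linarith

lemma intTri_natCast (n : ℕ) : intTri n = (n.choose 2 : ℕ) := by
  rw [intTri, Nat.choose_two_right]
  rcases n with _ | n
  · simp
  · push_cast
    simp

lemma intTri_neg_natCast (n : ℕ) : intTri (-n) = (n.choose 2 : ℕ) + n := by
  have h1 := two_mul_intTri (-n)
  have h2 := two_mul_intTri n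
  rw [intTri_natCast] at h2
  linarith

/-- The general term of Jacobi's theta series `∑ (-1)^k q^(k(k-1)/2) z^k`. -/
noncomputable def thetaTerm (q z : ℂ) (k : ℤ) : ℂ := (-1) ^ k * q ^ intTri k * z ^ k

lemma norm_thetaTerm (q z : ℂ) (k : ℤ) : ‖thetaTerm q z k‖ = ‖q‖ ^ intTri k * ‖z‖ ^ k := by
  simp [thetaTerm, norm_zpow]

lemma summable_norm_thetaTerm (hq0 : q ≠ 0) (hq : ‖q‖ < 1) (z : ℂ) :
    Summable fun k => ‖thetaTerm q z k‖ := by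
  have hq0' : ‖q‖ ≠ 0 := norm_ne_zero_iff.2 hq0
  simp only [norm_thetaTerm]
  refine Summable.of_nat_of_neg ?_ ?_
  · refine (summable_pow_choose_two_mul_pow (norm_nonneg q) hq ‖z‖).congr fun n => ?_
    rw [intTri_natCast, zpow_natCast, zpow_natCast]
  · refine (summable_pow_choose_two_mul_pow (norm_nonneg q) hq (‖q‖ * ‖z‖⁻¹)).congr fun n => ?_
    rw [intTri_neg_natCast, zpow_add₀ hq0', zpow_natCast, zpow_natCast, zpow_neg, zpow_natCast,
      mul_pow, inv_pow]
    ring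

/-- `1 / (q; q)_m`, extended by zero to negative `m`. -/
noncomputable def invPoch (q : ℂ) (m : ℤ) : ℂ := if 0 ≤ m then (qPoch q q m.toNat)⁻¹ else 0

lemma invPoch_natCast (q : ℂ) (n : ℕ) : invPoch q n = (qPoch q q n)⁻¹ := by simp [invPoch]

/-- Extension by zero keeps the recurrence valid for all integers: at m = -1 the factor 1 - q^0
vanishes. Sums over ℤ then need no boundary cases. -/
lemma invPoch_eq_mul_succ (hq0 : q ≠ 0) (hq : ‖q‖ < 1) (m : ℤ) :
    invPoch q m = (1 - q * q ^ m) * invPoch q (m + 1) := by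
  rcases lt_or_ge m 0 with h | h
  · rcases eq_or_lt_of_le (Int.add_one_le_iff.2 h) with h1 | h1
    · have : m = -1 := by omega
      subst this
      simp [invPoch, hq0]
    · simp [invPoch, h.not_ge, h1.not_ge]
  · lift m to ℕ using h
    have h1 : 1 - q * q ^ m ≠ 0 := one_sub_mul_pow_ne_zero hq hq m
    rw [← Nat.cast_succ, invPoch_natCast, invPoch_natCast, zpow_natCast, Nat.succ_eq_add_one,
      qPoch_succ, mul_inv]
    field_simp

lemma norm_invPoch_le (hq : ‖q‖ < 1) (m : ℤ) :
    ‖invPoch q m‖ ≤ Real.exp ((1 - ‖q‖)⁻¹ * ‖q‖ / (1 - ‖q‖)) := by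
  unfold invPoch
  split_ifs
  · exact norm_qPoch_inv_le_of_norm_le hq le_rfl hq _
  · rw [norm_zero]; positivity

/-- The general term of the finite form of the Jacobi triple product. -/
noncomputable def finiteThetaTerm (q z : ℂ) (N : ℕ) (k : ℤ) : ℂ :=
  qPoch q q (2 * N) * invPoch q (N + k) * invPoch q (N - k) * thetaTerm q z k

lemma thetaTerm_succ (hq0 : q ≠ 0) {z : ℂ} (hz : z ≠ 0) (k : ℤ) :
    thetaTerm q z (k + 1) = -(q ^ k * z * thetaTerm q z k) := by
  have h : intTri 1 = 0 := by decide
  rw [thetaTerm, thetaTerm, intTri_add, h, zpow_add₀ hq0, zpow_add₀ hq0, zpow_add₀ hz,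
    zpow_add₀ (by norm_num : (-1 : ℂ) ≠ 0)]
  simp
  ring

/-- This is the coefficientwise form of multiplication by (1 - z q^N)(1 - q^(N+1)/z), the new
factors of the product side. -/
lemma finiteThetaTerm_succ (hq0 : q ≠ 0) (hq : ‖q‖ < 1) {z : ℂ} (hz : z ≠ 0) (N : ℕ) (k : ℤ) :
    finiteThetaTerm q z (N + 1) k = (1 + q ^ (2 * N + 1)) * finiteThetaTerm q z N k -
      z * q ^ N * finiteThetaTerm q z N (k - 1) -
      q ^ (N + 1) / z * finiteThetaTerm q z N (k + 1) := by
  have t1 := thetaTerm_succ hq0 hz k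
  have t2 := thetaTerm_succ hq0 hz (k - 1)
  rw [sub_add_cancel] at t2
  have hy : q ^ k ≠ 0 := zpow_ne_zero k hq0
  have hy' : q ^ (k - 1) = q ^ k / q := zpow_sub_one₀ hq0 k
  have t3 : thetaTerm q z (k - 1) = -(q / (q ^ k * z) * thetaTerm q z k) := by
    rw [t2, hy']
    field_simp
  have a1 := invPoch_eq_mul_succ hq0 hq (N + k)
  have a2 := invPoch_eq_mul_succ hq0 hq (N + (k - 1))
  have b1 := invPoch_eq_mul_succ hq0 hq (N - k)
  have b2 := invPoch_eq_mul_succ hq0 hq (N - (k + 1))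
  have c1 : (N : ℤ) + (k - 1) + 1 = N + k := by ring
  have c2 : (N : ℤ) - (k + 1) + 1 = N - k := by ring
  have c3 : ((N + 1 : ℕ) : ℤ) + k = N + k + 1 := by push_cast; ring
  have c4 : ((N + 1 : ℕ) : ℤ) - k = N - k + 1 := by push_cast; ring
  have c5 : (N : ℤ) + (k + 1) = N + k + 1 := by ring
  have c6 : (N : ℤ) - (k - 1) = N - k + 1 := by ring
  have c7 : 2 * (N + 1) = 2 * N + 1 + 1 := by ring
  rw [c1] at a2
  rw [c2] at b2
  simp only [finiteThetaTerm]
  rw [c3, c4, c5, c6, c7, a2, b2, a1, b1, t1, t3, qPoch_succ, qPoch_succ]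
  have d1 : q ^ ((N : ℤ) + k) = q ^ N * q ^ k := by rw [zpow_add₀ hq0, zpow_natCast]
  have d2 : q ^ ((N : ℤ) - k) = q ^ N / q ^ k := by rw [zpow_sub₀ hq0, zpow_natCast]
  have d3 : q ^ ((N : ℤ) + (k - 1)) = q ^ N * (q ^ k / q) := by
    rw [zpow_add₀ hq0, zpow_natCast, hy']
  have d4 : q ^ ((N : ℤ) - (k + 1)) = q ^ N / (q ^ k * q) := by
    rw [zpow_sub₀ hq0, zpow_natCast, zpow_add₀ hq0, zpow_one]
  have d5 : q ^ (2 * N) = q ^ N * q ^ N := by ring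
  have d6 : q ^ (2 * N + 1) = q ^ N * q ^ N * q := by ring
  rw [d1, d2, d3, d4, d6, d5, pow_succ]
  generalize q ^ k = y at *
  generalize q ^ N = X at *
  generalize invPoch q (N + k + 1) = A
  generalize invPoch q (N - k + 1) = B
  generalize qPoch q q (2 * N) = Q
  generalize thetaTerm q z k = T
  field_simp
  ring

/-- The finite Jacobi triple product. -/
lemma hasSum_finiteThetaTerm (hq0 : q ≠ 0) (hq : ‖q‖ < 1) {z : ℂ} (hz : z ≠ 0) (N : ℕ) :
    HasSum (finiteThetaTerm q z N) (qPoch z q N * qPoch (q / z) q N) := by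
  induction N with
  | zero =>
    have h : ∀ k : ℤ, k ≠ 0 → finiteThetaTerm q z 0 k = 0 := by
      intro k hk
      rcases lt_or_gt_of_ne hk with h | h
      · simp [finiteThetaTerm, invPoch, h.not_ge]
      · simp [finiteThetaTerm, invPoch, h.not_ge]
    have := hasSum_single 0 h
    simpa [finiteThetaTerm, invPoch, thetaTerm, intTri] using this
  | succ N ih =>
    have h1 : HasSum (fun k : ℤ => finiteThetaTerm q z N (k - 1))
        (qPoch z q N * qPoch (q / z) q N) :=
      ((Equiv.subRight (1 : ℤ)).hasSum_iff (f := finiteThetaTerm q z N)).2 ih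
    have h2 : HasSum (fun k : ℤ => finiteThetaTerm q z N (k + 1))
        (qPoch z q N * qPoch (q / z) q N) :=
      ((Equiv.addRight (1 : ℤ)).hasSum_iff (f := finiteThetaTerm q z N)).2 ih
    have h := ((ih.mul_left (1 + q ^ (2 * N + 1))).sub (h1.mul_left (z * q ^ N))).sub
      (h2.mul_left (q ^ (N + 1) / z))
    simp only [← finiteThetaTerm_succ hq0 hq hz] at h
    convert! h using 1
    rw [qPoch_succ, qPoch_succ]
    field_simp
    ring

/-- The infinite product `∏_{n ≥ 1} (1 - z q^n)`. -/
noncomputable def eulerProd (q z : ℂ) : ℂ := ∏' n : ℕ, (1 - z * q ^ (n + 1))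

lemma summable_norm_mul_pow_succ (hq : ‖q‖ < 1) (z : ℂ) :
    Summable fun n : ℕ => ‖-(z * q ^ (n + 1))‖ := by
  simp only [norm_neg, norm_mul, norm_pow]
  exact ((summable_nat_add_iff 1).2
    (summable_geometric_of_lt_one (norm_nonneg q) hq)).mul_left _

lemma multipliable_eulerProd (hq : ‖q‖ < 1) (z : ℂ) :
    Multipliable fun n : ℕ => 1 - z * q ^ (n + 1) := by
  simpa only [← sub_eq_add_neg] using
    multipliable_one_add_of_summable (summable_norm_mul_pow_succ hq z)

lemma tendsto_qPoch_eulerProd (hq : ‖q‖ < 1) (z : ℂ) :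
    Tendsto (qPoch (z * q) q) atTop (𝓝 (eulerProd q z)) := by
  refine (multipliable_eulerProd hq z).hasProd.tendsto_prod_nat.congr fun N => ?_
  exact Finset.prod_congr rfl fun j _ => by ring

lemma eulerProd_ne_zero (hq : ‖q‖ < 1) {z : ℂ} (hz : ∀ n : ℕ, 1 - z * q ^ (n + 1) ≠ 0) :
    eulerProd q z ≠ 0 := by
  have := tprod_one_add_ne_zero_of_summable (f := fun n : ℕ => -(z * q ^ (n + 1)))
    (fun n => by rw [← sub_eq_add_neg]; exact hz n) (summable_norm_mul_pow_succ hq z)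
  simpa only [← sub_eq_add_neg, eulerProd] using this

lemma eulerProd_one_ne_zero (hq : ‖q‖ < 1) : eulerProd q 1 ≠ 0 :=
  eulerProd_ne_zero hq fun n => by rw [one_mul]; exact one_sub_pow_succ_ne_zero hq n

lemma tendsto_invPoch (hq : ‖q‖ < 1) {f : ℕ → ℤ} (hf : Tendsto f atTop atTop) :
    Tendsto (fun N => invPoch q (f N)) atTop (𝓝 (eulerProd q 1)⁻¹) := by
  have h1 : Tendsto (fun n : ℕ => (qPoch q q n)⁻¹) atTop (𝓝 (eulerProd q 1)⁻¹) := by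
    have := tendsto_qPoch_eulerProd hq 1
    rw [one_mul] at this
    exact this.inv₀ (eulerProd_one_ne_zero hq)
  have h2 : Tendsto (fun N => (f N).toNat) atTop atTop := by
    refine tendsto_atTop.2 fun b => ?_
    filter_upwards [hf.eventually_ge_atTop (b : ℤ)] with N hN
    omega
  refine (h1.comp h2).congr' ?_
  filter_upwards [hf.eventually_ge_atTop 0] with N hN
  simp [invPoch, hN]

/-- The Jacobi triple product identity. -/
lemma tsum_thetaTerm (hq0 : q ≠ 0) (hq : ‖q‖ < 1) {z : ℂ} (hz : z ≠ 0) :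
    ∑' k, thetaTerm q z k = eulerProd q 1 * ((1 - z) * eulerProd q z * eulerProd q z⁻¹) := by
  have hE := eulerProd_one_ne_zero hq
  set C := Real.exp ((1 - ‖q‖)⁻¹ * ‖q‖ / (1 - ‖q‖)) with hC
  have hlim : Tendsto (fun N : ℕ => ∑' k, finiteThetaTerm q z N k) atTop
      (𝓝 (∑' k, eulerProd q 1 * (eulerProd q 1)⁻¹ * (eulerProd q 1)⁻¹ * thetaTerm q z k)) := by
    refine tendsto_tsum_of_dominated_convergence
      (bound := fun k => Real.exp (‖q‖ / (1 - ‖q‖)) * C * C * ‖thetaTerm q z k‖)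
      ((summable_norm_thetaTerm hq0 hq z).mul_left _) (fun k => ?_)
      (Eventually.of_forall fun N k => ?_)
    · have h0 : Tendsto (fun N : ℕ => (N : ℤ)) atTop atTop := tendsto_natCast_atTop_atTop
      have h1 := tendsto_invPoch hq (tendsto_atTop_add_const_right _ k h0)
      have h2 := tendsto_invPoch hq (tendsto_atTop_add_const_right _ (-k) h0)
      have h3 := (tendsto_qPoch_eulerProd hq 1).comp
        (tendsto_id.const_mul_atTop' (show 0 < 2 by norm_num))
      rw [one_mul] at h3
      exact ((h3.mul h1).mul h2).mul_const _
    · rw [finiteThetaTerm, norm_mul, norm_mul, norm_mul]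
      have h1 := norm_qPoch_le hq q (2 * N)
      have h2 := norm_invPoch_le hq (N + k)
      have h3 := norm_invPoch_le hq (N - k)
      gcongr
  simp only [(hasSum_finiteThetaTerm hq0 hq hz _).tsum_eq] at hlim
  -- `eulerProd` starts at exponent 1, so the factor 1 - z of (z; q)_{N+1} is split off; this
  -- requires N + 1 in place of N.
  have hprod : Tendsto (fun N : ℕ => qPoch z q (N + 1) * qPoch (q / z) q (N + 1)) atTop
      (𝓝 ((1 - z) * eulerProd q z * eulerProd q z⁻¹)) := by
    simp only [qPoch_succ_left z]
    have h1 := (tendsto_qPoch_eulerProd hq z).const_mul (1 - z)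
    have h2 := (tendsto_qPoch_eulerProd hq z⁻¹).comp (tendsto_add_atTop_nat 1)
    rw [mul_comm, ← div_eq_mul_inv] at h2
    exact h1.mul h2
  have h := tendsto_nhds_unique (hlim.comp (tendsto_add_atTop_nat 1)) hprod
  rw [tsum_mul_left, mul_inv_cancel₀ hE, one_mul] at h
  rw [← h, mul_inv_cancel_left₀ hE]

end JacobiTripleProduct

/-! ### The Lambert series of a(q) from the trisection of a theta cube. -/

section CubicTheta

variable {q : ℂ}

lemma summable_pow_natAbs {r : ℝ} (hr : 0 ≤ r) (hr1 : r < 1) :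
    Summable fun k : ℤ => r ^ k.natAbs := by
  refine Summable.of_nat_of_neg ?_ ?_ <;>
  simpa using summable_geometric_of_lt_one hr hr1

/-- The quadratic form is at least (|m| + |n|) / 2, so a product of two geometric series of ratio
√‖q‖ dominates. -/
lemma summable_norm_cubicTheta (hq : ‖q‖ < 1) :
    Summable fun p : ℤ × ℤ => ‖q ^ (p.1 ^ 2 + p.1 * p.2 + p.2 ^ 2)‖ := by
  have hr0 := Real.sqrt_nonneg ‖q‖
  have hr1 : √‖q‖ < 1 := (Real.sqrt_lt' one_pos).2 (by simpa using hq)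
  have hs := summable_pow_natAbs hr0 hr1
  refine Summable.of_nonneg_of_le (fun _ => norm_nonneg _) (fun p => ?_)
    (hs.mul_of_nonneg hs (fun _ => by positivity) (fun _ => by positivity))
  obtain ⟨m, n⟩ := p
  dsimp only
  have h0 : 0 ≤ m ^ 2 + m * n + n ^ 2 := by nlinarith [sq_nonneg (m + n), sq_nonneg m, sq_nonneg n]
  obtain ⟨e, he⟩ := Int.eq_ofNat_of_zero_le h0
  have h1 : m.natAbs + n.natAbs ≤ 2 * e := by
    have a1 : m.natAbs ≤ m.natAbs ^ 2 := Nat.le_self_pow two_ne_zero _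
    have a2 : n.natAbs ≤ n.natAbs ^ 2 := Nat.le_self_pow two_ne_zero _
    zify at a1 a2 ⊢
    rw [sq_abs] at a1 a2
    nlinarith [sq_nonneg (m + n)]
  rw [he, zpow_natCast, norm_pow, ← pow_add]
  calc ‖q‖ ^ e = √‖q‖ ^ (2 * e) := by rw [pow_mul, Real.sq_sqrt (norm_nonneg q)]
    _ ≤ _ := pow_le_pow_of_le_one hr0 hr1.le h1

lemma thetaTerm_mul (q w z : ℂ) (k : ℤ) : thetaTerm q (w * z) k = w ^ k * thetaTerm q z k := by
  rw [thetaTerm, thetaTerm, mul_zpow]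
  ring

lemma hasSum_thetaTerm_cube (hq0 : q ≠ 0) (hq : ‖q‖ < 1) {w z : ℂ} (hw : w ≠ 0) :
    HasSum (fun x : ℤ × ℤ × ℤ => w ^ (x.1 + (x.2.1 + x.2.2)) *
      (thetaTerm q z x.1 * (thetaTerm q z x.2.1 * thetaTerm q z x.2.2)))
      ((∑' k, thetaTerm q (w * z) k) ^ 3) := by
  have h1 := summable_norm_thetaTerm hq0 hq (w * z)
  have h2 := h1.mul_norm h1
  have h3 := summable_mul_of_summable_norm h1 h2
  have h4 := h3.hasSum
  rw [← tsum_mul_tsum_of_summable_norm h1 h2, ← tsum_mul_tsum_of_summable_norm h1 h1] at h4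
  convert! h4 using 1
  · ext x
    simp only [thetaTerm_mul, zpow_add₀ hw]
    ring
  · ring

lemma root_filter {ζ w : ℂ} (h1 : ζ + w = -1) (h2 : ζ * w = 1) (s : ℤ) :
    1 ^ s + ζ ^ s + w ^ s = if 3 ∣ s then 3 else 0 := by
  have hζ : ζ ≠ 0 := left_ne_zero_of_mul_eq_one h2
  have hw : w ≠ 0 := right_ne_zero_of_mul_eq_one h2
  have hζ2 : ζ ^ 2 = w := by linear_combination ζ * h1 - h2 - h1
  have hw2 : w ^ 2 = ζ := by linear_combination w * h1 - h2 - h1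
  have hζ3 : ζ ^ (3 : ℤ) = 1 := by
    rw [show (3 : ℤ) = ((3 : ℕ) : ℤ) by rfl, zpow_natCast, pow_succ, hζ2, mul_comm, h2]
  have hw3 : w ^ (3 : ℤ) = 1 := by
    rw [show (3 : ℤ) = ((3 : ℕ) : ℤ) by rfl, zpow_natCast, pow_succ, hw2, h2]
  have key : ∀ r : ℤ, ζ ^ (3 * (s / 3) + r) = ζ ^ r ∧ w ^ (3 * (s / 3) + r) = w ^ r := by
    intro r
    rw [zpow_add₀ hζ, zpow_mul, hζ3, zpow_add₀ hw, zpow_mul, hw3]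
    simp
  have hs : s = 3 * (s / 3) + s % 3 := by omega
  have hr : s % 3 = 0 ∨ s % 3 = 1 ∨ s % 3 = 2 := by omega
  obtain ⟨k1, k2⟩ := key (s % 3)
  rw [← hs] at k1 k2
  rw [k1, k2, one_zpow]
  rcases hr with hr | hr | hr
  · rw [if_pos (Int.dvd_of_emod_eq_zero hr), hr]
    norm_num
  · rw [if_neg (by omega), hr, zpow_one, zpow_one]
    linear_combination h1
  · rw [if_neg (by omega), hr, show (2 : ℤ) = ((2 : ℕ) : ℤ) by rfl, zpow_natCast, zpow_natCast,
      hζ2, hw2]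
    linear_combination h1

/-- Three indices with sum 3m are written as m plus deviations i, j, -i-j. The linear parts cancel,
and half the sum of the squared deviations is i² + i j + j². -/
lemma thetaTerm_mul_mul (hq0 : q ≠ 0) {z : ℂ} (hz : z ≠ 0) (i j m : ℤ) :
    thetaTerm q z (i + m) * (thetaTerm q z (j + m) * thetaTerm q z (m - i - j)) =
      q ^ (i ^ 2 + i * j + j ^ 2) * thetaTerm (q ^ 3) (z ^ 3) m := by
  have e : intTri (i + m) + (intTri (j + m) + intTri (m - i - j)) =
      (i ^ 2 + i * j + j ^ 2) + (intTri m + (intTri m + intTri m)) := by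
    have h1 := two_mul_intTri (i + m)
    have h2 := two_mul_intTri (j + m)
    have h3 := two_mul_intTri (m - i - j)
    have h4 := two_mul_intTri m
    linarith
  have e2 : (i + m) + ((j + m) + (m - i - j)) = m + (m + m) := by ring
  have hn : (-1 : ℂ) ≠ 0 := by norm_num
  have es : (-1 : ℂ) ^ m * (-1 : ℂ) ^ m = 1 := by
    rw [← mul_zpow]; norm_num
  simp only [thetaTerm]
  calc _ = (-1 : ℂ) ^ ((i + m) + ((j + m) + (m - i - j))) *
        q ^ (intTri (i + m) + (intTri (j + m) + intTri (m - i - j))) *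
        z ^ ((i + m) + ((j + m) + (m - i - j))) := by
        simp only [zpow_add₀ hn, zpow_add₀ hq0, zpow_add₀ hz]
        ring
    _ = _ := by
        rw [e, e2]
        have p1 : (q ^ 3) ^ intTri m = q ^ intTri m * (q ^ intTri m * q ^ intTri m) := by
          rw [pow_succ, pow_two, mul_zpow, mul_zpow, mul_assoc]
        have p2 : (z ^ 3) ^ m = z ^ m * (z ^ m * z ^ m) := by
          rw [pow_succ, pow_two, mul_zpow, mul_zpow, mul_assoc]
        rw [p1, p2]
        simp only [zpow_add₀ hn, zpow_add₀ hq0 (_ + _) (_ + _), zpow_add₀ hq0 (intTri m),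
          zpow_add₀ hz, es]
        ring

/-- The trisection of the cube of the theta series. -/
lemma sum_thetaTerm_cube (hq0 : q ≠ 0) (hq : ‖q‖ < 1) {ζ w z : ℂ} (h1 : ζ + w = -1)
    (h2 : ζ * w = 1) (hz : z ≠ 0) :
    (∑' k, thetaTerm q z k) ^ 3 + (∑' k, thetaTerm q (ζ * z) k) ^ 3 +
      (∑' k, thetaTerm q (w * z) k) ^ 3 =
      3 * cubicTheta q * ∑' k, thetaTerm (q ^ 3) (z ^ 3) k := by
  have hζ : ζ ≠ 0 := left_ne_zero_of_mul_eq_one h2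
  have hw : w ≠ 0 := right_ne_zero_of_mul_eq_one h2
  have s1 := hasSum_thetaTerm_cube hq0 hq (z := z) one_ne_zero
  have s2 := hasSum_thetaTerm_cube hq0 hq (z := z) hζ
  have s3 := hasSum_thetaTerm_cube hq0 hq (z := z) hw
  have s := ((s1.add s2).add s3).tsum_eq
  rw [one_mul] at s
  rw [← s]
  simp only [← add_mul, root_filter h1 h2]
  -- The map is a bijection onto the triples whose sum is divisible by 3, the only ones the
  -- root-of-unity filter retains.
  have hinj : Function.Injective fun y : (ℤ × ℤ) × ℤ =>
      ((y.1.1 + y.2, y.1.2 + y.2, y.2 - y.1.1 - y.1.2) : ℤ × ℤ × ℤ) := by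
    rintro ⟨⟨a, b⟩, c⟩ ⟨⟨a', b'⟩, c'⟩ h
    simp only [Prod.mk.injEq] at h ⊢
    omega
  rw [← hinj.tsum_eq]
  · have hq3 : ‖q ^ 3‖ < 1 := norm_pow_succ_lt_one hq 2
    rw [cubicTheta, mul_assoc, tsum_mul_tsum_of_summable_norm (summable_norm_cubicTheta hq)
      (summable_norm_thetaTerm (pow_ne_zero 3 hq0) hq3 (z ^ 3)), ← tsum_mul_left]
    refine tsum_congr fun y => ?_
    rw [if_pos ⟨y.2, by ring⟩, thetaTerm_mul_mul hq0 hz]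
  · rintro ⟨a, b, c⟩ h
    have hd : (3 : ℤ) ∣ a + (b + c) := by
      by_contra hd
      simp [hd] at h
    obtain ⟨m, hm⟩ := hd
    refine ⟨((a - m, b - m), m), ?_⟩
    simp only [Prod.mk.injEq]
    omega

/-- The logarithmic derivative of `eulerProd q`. -/
noncomputable def eulerLogDeriv (q z : ℂ) : ℂ :=
  ∑' n : ℕ, -(q ^ (n + 1)) / (1 - z * q ^ (n + 1))

lemma one_sub_mul_pow_succ_ne_zero (hq : ‖q‖ < 1) {z : ℂ} (hz : ‖z‖ = 1) (n : ℕ) :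
    1 - z * q ^ (n + 1) ≠ 0 := by
  refine one_sub_ne_zero_of_norm_lt ?_
  rw [norm_mul, hz, one_mul]
  exact norm_pow_succ_lt_one hq n

lemma summable_eulerLogDeriv (hq : ‖q‖ < 1) {z : ℂ} (hz : ‖z‖ = 1) :
    Summable fun n : ℕ => -(q ^ (n + 1)) / (1 - z * q ^ (n + 1)) := by
  refine Summable.of_norm_bounded (((summable_nat_add_iff 1).2
    (summable_geometric_of_lt_one (norm_nonneg q) hq)).mul_right (1 - ‖q‖)⁻¹) fun n => ?_
  rw [div_eq_mul_inv, norm_mul, norm_neg, norm_pow]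
  gcongr
  refine norm_inv_one_sub_le ?_ hq
  rw [norm_mul, hz, one_mul]
  exact norm_pow_succ_le hq n

lemma hasDerivAt_eulerProd (hq : ‖q‖ < 1) {z : ℂ} (hz : ‖z‖ = 1) :
    HasDerivAt (eulerProd q) (eulerProd q z * eulerLogDeriv q z) z := by
  -- Any radius above 1 would do: the disc only has to contain the unit circle, where the
  -- derivatives are taken.
  have hs : IsOpen (Metric.ball (0 : ℂ) 2) := Metric.isOpen_ball
  have hzs : z ∈ Metric.ball (0 : ℂ) 2 := by simp [hz]
  have hn0 := one_sub_mul_pow_succ_ne_zero hq hz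
  have hnz := eulerProd_ne_zero hq hn0
  have hd : ∀ n : ℕ, Differentiable ℂ fun x : ℂ => 1 - x * q ^ (n + 1) := fun n => by fun_prop
  have hml : MultipliableLocallyUniformlyOn (fun (n : ℕ) (x : ℂ) => 1 - x * q ^ (n + 1))
      (Metric.ball (0 : ℂ) 2) := by
    simp only [sub_eq_add_neg]
    refine Summable.multipliableLocallyUniformlyOn_nat_one_add hs
      (((summable_nat_add_iff 1).2
        (summable_geometric_of_lt_one (norm_nonneg q) hq)).mul_left 2)
      (Eventually.of_forall fun n x hx => ?_) (fun n => by fun_prop)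
    rw [norm_neg, norm_mul, norm_pow]
    gcongr
    exact (mem_ball_zero_iff.1 hx).le
  have hdiff : DifferentiableOn ℂ (eulerProd q) (Metric.ball (0 : ℂ) 2) :=
    hml.hasProdLocallyUniformlyOn.differentiableOn (Eventually.of_forall fun _ => by
      simpa [Finset.prod_fn] using
        DifferentiableOn.finsetProd (fun n _ => (hd n).differentiableOn)) hs
  have hlog : ∀ n : ℕ, logDeriv (fun x : ℂ => 1 - x * q ^ (n + 1)) z =
      -(q ^ (n + 1)) / (1 - z * q ^ (n + 1)) := fun n => by
    have : HasDerivAt (fun x : ℂ => 1 - x * q ^ (n + 1)) (-(q ^ (n + 1))) z := by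
      simpa using ((hasDerivAt_id z).mul_const (q ^ (n + 1))).const_sub 1
    rw [logDeriv_apply, this.deriv]
  have h := logDeriv_tprod_eq_tsum hs hzs hn0 (fun n => (hd n).differentiableOn)
    (by simpa only [hlog] using summable_eulerLogDeriv hq hz) hml hnz
  simp only [hlog] at h
  have h' : deriv (eulerProd q) z / eulerProd q z = eulerLogDeriv q z := h
  rw [← h', mul_div_cancel₀ _ hnz]
  exact (hdiff.differentiableAt (hs.mem_nhds hzs)).hasDerivAt

/-- The derivative is kept free of division by θ(z), so that it also applies at the zero z = 1. -/
lemma hasDerivAt_theta (hq0 : q ≠ 0) (hq : ‖q‖ < 1) {z : ℂ} (hz : ‖z‖ = 1) :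
    HasDerivAt (fun z => ∑' k, thetaTerm q z k)
      (eulerProd q 1 * (eulerProd q z * eulerProd q z⁻¹) *
        (-1 + (1 - z) * (eulerLogDeriv q z - eulerLogDeriv q z⁻¹ * (z⁻¹) ^ 2))) z := by
  have hz0 : z ≠ 0 := norm_ne_zero_iff.1 (by rw [hz]; exact one_ne_zero)
  have hz' : ‖z⁻¹‖ = 1 := by rw [norm_inv, hz, inv_one]
  have h1 := hasDerivAt_eulerProd hq hz
  have h2 := (hasDerivAt_eulerProd hq hz').comp z (hasDerivAt_inv hz0)
  have h3 := ((((hasDerivAt_id z).const_sub 1).mul h1).mul h2).const_mul (eulerProd q 1)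
  refine (h3.congr_of_eventuallyEq ?_).congr_deriv ?_
  · filter_upwards [isOpen_ne.mem_nhds hz0] with y hy
    exact tsum_thetaTerm hq0 hq hy
  · simp only [Function.comp_apply, id, Pi.mul_apply]
    rw [inv_pow]
    ring

lemma eulerProd_mul_mul (hq : ‖q‖ < 1) {ζ w : ℂ} (h1 : ζ + w = -1) (h2 : ζ * w = 1) :
    eulerProd q 1 * (eulerProd q ζ * eulerProd q w) = eulerProd (q ^ 3) 1 := by
  have m := multipliable_eulerProd hq
  simp only [eulerProd]
  rw [← (m ζ).tprod_mul (m w), ← (m 1).tprod_mul ((m ζ).mul (m w))]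
  refine tprod_congr fun n => ?_
  rw [← pow_mul, mul_comm 3, pow_mul]
  generalize q ^ (n + 1) = x
  linear_combination (-x + x ^ 2) * h1 + (x ^ 2 - x ^ 3) * h2

/-- Differentiate the trisection identity at z = 1. The cube of θ(z) contributes nothing since θ(1)
= 0, and the right side contributes -9 a(q) E³ with E = `eulerProd (q ^ 3) 1`. By the triple product
θ(ζ) = (1 - ζ) E and θ(w) = (1 - w) E, so E³ cancels. -/
lemma cubicTheta_eq_eulerLogDeriv (hq0 : q ≠ 0) (hq : ‖q‖ < 1) {ζ w : ℂ} (h1 : ζ + w = -1)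
    (h2 : ζ * w = 1) (hζ : ‖ζ‖ = 1) (hw : ‖w‖ = 1) :
    cubicTheta q = 1 - 2 * ((1 - w) * eulerLogDeriv q ζ + (1 - ζ) * eulerLogDeriv q w) := by
  have hq3 : ‖q ^ 3‖ < 1 := norm_pow_succ_lt_one hq 2
  have hq30 : q ^ 3 ≠ 0 := pow_ne_zero 3 hq0
  have hζ0 : ζ ≠ 0 := left_ne_zero_of_mul_eq_one h2
  have hw0 : w ≠ 0 := right_ne_zero_of_mul_eq_one h2
  have hζi : ζ⁻¹ = w := inv_eq_of_mul_eq_one_right h2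
  have hwi : w⁻¹ = ζ := inv_eq_of_mul_eq_one_left h2
  have d : ∀ y : ℂ, ‖y‖ = 1 → HasDerivAt (fun z => (∑' k, thetaTerm q (y * z) k) ^ 3)
      (3 * (∑' k, thetaTerm q y k) ^ 2 *
      (eulerProd q 1 * (eulerProd q y * eulerProd q y⁻¹) *
        (-1 + (1 - y) * (eulerLogDeriv q y - eulerLogDeriv q y⁻¹ * (y⁻¹) ^ 2)) * y)) 1 := by
    intro y hy
    have e := hasDerivAt_theta hq0 hq hy
    rw [← mul_one y] at e
    have e2 := (e.comp 1 ((hasDerivAt_id (1 : ℂ)).const_mul y)).fun_pow 3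
    simpa [Function.comp_def] using e2
  have d1 := d 1 norm_one
  simp only [one_mul] at d1
  have dR := ((hasDerivAt_theta hq30 hq3 (z := 1 ^ 3) (by simp)).comp 1
    (hasDerivAt_pow 3 (1 : ℂ))).const_mul (3 * cubicTheta q)
  have dL := (d1.add (d ζ hζ)).add (d w hw)
  have key := dL.unique (dR.congr_of_eventuallyEq (by
    filter_upwards [isOpen_ne.mem_nhds (one_ne_zero (α := ℂ))] with z hz
    exact sum_thetaTerm_cube hq0 hq h1 h2 hz))
  have hE := eulerProd_mul_mul hq h1 h2
  have hE0 : eulerProd (q ^ 3) 1 ≠ 0 := eulerProd_one_ne_zero hq3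
  rw [tsum_thetaTerm hq0 hq one_ne_zero, tsum_thetaTerm hq0 hq hζ0, tsum_thetaTerm hq0 hq hw0,
    hζi, hwi] at key
  norm_num at key
  rw [mul_comm (eulerProd q w) (eulerProd q ζ), hE] at key
  have e1 : eulerProd q 1 * ((1 - ζ) * eulerProd q ζ * eulerProd q w) =
      (1 - ζ) * eulerProd (q ^ 3) 1 := by linear_combination (1 - ζ) * hE
  have e2 : eulerProd q 1 * ((1 - w) * eulerProd q w * eulerProd q ζ) =
      (1 - w) * eulerProd (q ^ 3) 1 := by linear_combination (1 - w) * hE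
  have hζ2 : ζ ^ 2 = w := by linear_combination ζ * h1 - h2 - h1
  have hw2 : w ^ 2 = ζ := by linear_combination w * h1 - h2 - h1
  have k1 : (1 - ζ) ^ 2 * ζ = -3 * w := by linear_combination (ζ - 2) * hζ2 + h2 + h1
  have k2 : (1 - w) ^ 2 * w = -3 * ζ := by linear_combination (w - 2) * hw2 + h2 + h1
  rw [e1, e2, hζ2, hw2] at key
  generalize eulerLogDeriv q ζ = l1 at *
  generalize eulerLogDeriv q w = l2 at *
  generalize eulerProd (q ^ 3) 1 = E at *
  have hE9 : 9 * E ^ 3 ≠ 0 := mul_ne_zero (by norm_num) (pow_ne_zero 3 hE0)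
  have key2 : cubicTheta q = w * (-1 + (1 - ζ) * (l1 - l2 * ζ)) +
      ζ * (-1 + (1 - w) * (l2 - l1 * w)) := by
    refine mul_left_cancel₀ hE9 ?_
    linear_combination key - 3 * E ^ 3 * (-1 + (1 - ζ) * (l1 - l2 * ζ)) * k1 -
      3 * E ^ 3 * (-1 + (1 - w) * (l2 - l1 * w)) * k2
  linear_combination key2 - h1 - h2 * (l1 - l2 * ζ) - h2 * (l2 - l1 * w) - h2 * l1 - h2 * l2

/-- Over the common denominator (1 - ζ x)(1 - w x) = (1 - x³) / (1 - x), the numerator on the left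
reduces to -3 x. -/
lemma lambert_cubic_term {ζ w x : ℂ} (h1 : ζ + w = -1) (h2 : ζ * w = 1) (hx : 1 - x ^ 3 ≠ 0) :
    (1 - w) * (-x / (1 - ζ * x)) + (1 - ζ) * (-x / (1 - w * x)) =
      -3 * (x / (1 - x ^ 3) - x ^ 2 / (1 - x ^ 3)) := by
  have e : (1 - x) * ((1 - ζ * x) * (1 - w * x)) = 1 - x ^ 3 := by
    linear_combination (-x + x ^ 2) * h1 + (x ^ 2 - x ^ 3) * h2
  rw [← e] at hx ⊢
  have hx1 := left_ne_zero_of_mul hx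
  have hx2 := left_ne_zero_of_mul (right_ne_zero_of_mul hx)
  have hx3 := right_ne_zero_of_mul (right_ne_zero_of_mul hx)
  have e2 : x / ((1 - x) * ((1 - ζ * x) * (1 - w * x))) -
      x ^ 2 / ((1 - x) * ((1 - ζ * x) * (1 - w * x))) = x / ((1 - ζ * x) * (1 - w * x)) := by
    rw [← sub_div, show x - x ^ 2 = (1 - x) * x by ring, mul_div_mul_left _ _ hx1]
  rw [e2, mul_div, mul_div, mul_div, div_add_div _ _ hx2 hx3]
  congr 1
  linear_combination -x * (((-1 + x * (ζ + w - 2)) * h1) - 2 * x * h2)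

lemma cubicTheta_zero : cubicTheta 0 = 1 := by
  rw [cubicTheta, tsum_eq_single (0, 0)]
  · simp
  · rintro ⟨m, n⟩ h
    refine zero_zpow _ fun h0 => h ?_
    dsimp only at h0
    have h1 : m = 0 := by nlinarith [sq_nonneg (m + 2 * n), sq_nonneg m]
    subst h1
    simpa using h0

/-- The Lambert series expansion of the cubic theta function. -/
theorem cubicTheta_eq_lambertSeries (hq : ‖q‖ < 1) :
    cubicTheta q = 1 + 6 * (lambertSeries q (q ^ 3) - lambertSeries (q ^ 2) (q ^ 3)) := by
  -- The theta-function argument needs q ≠ 0; at q = 0 both sides equal 1.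
  rcases eq_or_ne q 0 with rfl | hq0
  · simp [cubicTheta_zero, lambertSeries]
  have hζ := Complex.isPrimitiveRoot_exp 3 (by norm_num)
  set ζ := Complex.exp (2 * Real.pi * Complex.I / (3 : ℕ)) with hζdef
  have h3 : ζ ^ 3 = 1 := hζ.pow_eq_one
  have hg : ζ + ζ ^ 2 = -1 := by
    have := hζ.geom_sum_eq_zero (by norm_num)
    simp only [Finset.sum_range_succ, Finset.sum_range_zero] at this
    linear_combination this
  have h2 : ζ * ζ ^ 2 = 1 := by rw [← pow_succ', h3]
  have n1 : ‖ζ‖ = 1 := hζ.norm'_eq_one (by norm_num)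
  have n2 : ‖ζ ^ 2‖ = 1 := by rw [norm_pow, n1, one_pow]
  have hq3 : ‖q ^ 3‖ < 1 := norm_pow_succ_lt_one hq 2
  rw [cubicTheta_eq_eulerLogDeriv hq0 hq hg h2 n1 n2, eulerLogDeriv, eulerLogDeriv, lambertSeries,
    lambertSeries, ← (summable_lambertSeries hq3 hq).tsum_sub
      (summable_lambertSeries hq3 (norm_pow_succ_lt_one hq 1)), ← tsum_mul_left, ← tsum_mul_left,
    ← ((summable_eulerLogDeriv hq n1).mul_left _).tsum_add
      ((summable_eulerLogDeriv hq n2).mul_left _)]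
  have e : ∀ n : ℕ, (1 - ζ ^ 2) * (-(q ^ (n + 1)) / (1 - ζ * q ^ (n + 1))) +
      (1 - ζ) * (-(q ^ (n + 1)) / (1 - ζ ^ 2 * q ^ (n + 1))) =
      -3 * (q ^ (n + 1) / (1 - (q ^ 3) ^ (n + 1)) - (q ^ 2) ^ (n + 1) / (1 - (q ^ 3) ^ (n + 1))) := by
    intro n
    have h := one_sub_pow_succ_ne_zero hq3 n
    rw [← pow_mul, mul_comm 3, pow_mul] at h ⊢
    rw [← pow_mul q 2, mul_comm 2, pow_mul]
    exact lambert_cubic_term hg h2 h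
  simp only [e, tsum_mul_left]
  ring

end CubicTheta

/-! ### The expansions of a(q), with exponents rewritten in base q³. -/

section Expansions

lemma hasSum_pnat_of_hasSum_succ {f : ℕ → ℂ} {S : ℂ} (h : HasSum (fun n => f (n + 1)) S) :
    HasSum (fun n : ℕ+ => f n) S := by
  refine (Equiv.pnatEquivNat.hasSum_iff.2 h).congr_fun ?_
  intro n
  simp [PNat.natPred_add_one]

lemma seriesTendsTo_iff {u : ℕ → ℂ} {S : ℂ} :
    SeriesTendsTo u S ↔ Tendsto (fun N => ∑ n ∈ Finset.range N, u (n + 1)) atTop (𝓝 S) := by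
  have h : ∀ N, ∑ n ∈ Finset.Icc 1 N, u n = ∑ n ∈ Finset.range N, u (n + 1) := by
    intro N
    induction N with
    | zero => simp
    | succ N ih => rw [Finset.sum_Icc_succ_top (by omega), ih, Finset.sum_range_succ]
  simp only [SeriesTendsTo, h]

lemma two_mul_choose_two_add (n : ℕ) : 2 * n.choose 2 + n = n ^ 2 := by
  induction n with
  | zero => rfl
  | succ n ih =>
    rw [Nat.choose_succ_succ' n 1, Nat.choose_one_right]
    linarith

lemma pow_pentagonal_sub (q : ℂ) (n : ℕ) :
    q ^ ((3 * n ^ 2 - n) / 2) = (q ^ 3) ^ (n.choose 2) * q ^ n := by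
  rw [← pow_mul, ← pow_add]
  congr 1
  have := two_mul_choose_two_add n
  omega

lemma pow_pentagonal_add (q : ℂ) (n : ℕ) :
    q ^ ((3 * n ^ 2 + n) / 2) = (q ^ 3) ^ (n.choose 2) * (q ^ 2) ^ n := by
  rw [← pow_mul, ← pow_mul, ← pow_add]
  congr 1
  have := two_mul_choose_two_add n
  omega

variable {q : ℂ}

lemma cubicTheta_alternating (hq : ‖q‖ < 1) :
    ∃ S₁ S₂ : ℂ,
      HasSum (fun n : ℕ+ => (-1 : ℂ) ^ (n : ℕ) * q ^ ((3 * (n : ℕ) ^ 2 - n) / 2) /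
        (qPoch q (q ^ 3) n * (1 - q ^ (3 * (n : ℕ))))) S₁ ∧
      HasSum (fun n : ℕ+ => (-1 : ℂ) ^ (n : ℕ) * q ^ ((3 * (n : ℕ) ^ 2 + n) / 2) /
        (qPoch (q ^ 2) (q ^ 3) n * (1 - q ^ (3 * (n : ℕ))))) S₂ ∧
      cubicTheta q = 1 - 6 * S₁ + 6 * S₂ := by
  have hq2 : ‖q ^ 2‖ < 1 := norm_pow_succ_lt_one hq 1
  have hq3 : ‖q ^ 3‖ < 1 := norm_pow_succ_lt_one hq 2
  refine ⟨-lambertSeries q (q ^ 3), -lambertSeries (q ^ 2) (q ^ 3), ?_, ?_, ?_⟩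
  · refine hasSum_pnat_of_hasSum_succ (f := fun n => (-1 : ℂ) ^ n * q ^ ((3 * n ^ 2 - n) / 2) /
      (qPoch q (q ^ 3) n * (1 - q ^ (3 * n)))) ?_
    refine (hasSum_alternating hq3 hq).neg.congr_fun fun n => ?_
    rw [pow_pentagonal_sub, pow_mul, pow_succ (-1 : ℂ)]
    ring
  · refine hasSum_pnat_of_hasSum_succ (f := fun n => (-1 : ℂ) ^ n * q ^ ((3 * n ^ 2 + n) / 2) /
      (qPoch (q ^ 2) (q ^ 3) n * (1 - q ^ (3 * n)))) ?_
    refine (hasSum_alternating hq3 hq2).neg.congr_fun fun n => ?_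
    rw [pow_pentagonal_add, pow_mul, pow_succ (-1 : ℂ)]
    ring
  · rw [cubicTheta_eq_lambertSeries hq]
    ring

/-- Used with u = x p^n and v = p^(n+1) to merge the two fractions of `hasSum_durfee` into the
single fraction of the theorem. -/
lemma div_add_div_durfee {u v R Y : ℂ} (hu : 1 - u ≠ 0) (hv : 1 - v ≠ 0) :
    R * Y * (1 - u * v) / ((1 - u) * (1 - v)) = R * Y / (1 - u) + R * v * Y / (1 - v) := by
  field_simp
  ring

lemma cubicTheta_durfee (hq : ‖q‖ < 1) :
    ∃ S₁ S₂ : ℂ,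
      HasSum (fun n : ℕ+ => q ^ (3 * (n : ℕ) ^ 2 - 2 * n) * (1 - q ^ (6 * (n : ℕ) - 2)) /
        ((1 - q ^ (3 * (n : ℕ) - 2)) * (1 - q ^ (3 * (n : ℕ))))) S₁ ∧
      HasSum (fun n : ℕ+ => q ^ (3 * (n : ℕ) ^ 2 - n) * (1 - q ^ (6 * (n : ℕ) - 1)) /
        ((1 - q ^ (3 * (n : ℕ) - 1)) * (1 - q ^ (3 * (n : ℕ))))) S₂ ∧
      cubicTheta q = 1 + 6 * S₁ - 6 * S₂ := by
  have hq2 : ‖q ^ 2‖ < 1 := norm_pow_succ_lt_one hq 1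
  have hq3 : ‖q ^ 3‖ < 1 := norm_pow_succ_lt_one hq 2
  refine ⟨lambertSeries q (q ^ 3), lambertSeries (q ^ 2) (q ^ 3), ?_, ?_, ?_⟩
  · refine hasSum_pnat_of_hasSum_succ (f := fun n => q ^ (3 * n ^ 2 - 2 * n) *
      (1 - q ^ (6 * n - 2)) / ((1 - q ^ (3 * n - 2)) * (1 - q ^ (3 * n)))) ?_
    refine (hasSum_durfee hq3 hq).congr_fun fun n => ?_
    have e1 : 3 * (n + 1) ^ 2 - 2 * (n + 1) = 3 * (n * (n + 1)) + (n + 1) := by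
      rw [Nat.sub_eq_iff_eq_add (by nlinarith)]; ring
    have e2 : 6 * (n + 1) - 2 = 3 * n + 1 + 3 * (n + 1) := by omega
    have e3 : 3 * (n + 1) - 2 = 3 * n + 1 := by omega
    have e4 : q * (q ^ 3) ^ n = q ^ (3 * n + 1) := by ring
    have e5 : (q ^ 3) ^ ((n + 1) * (n + 1)) = q ^ (3 * (n * (n + 1))) * q ^ (3 * (n + 1)) := by
      ring
    have h1 : 1 - q ^ (3 * n + 1) ≠ 0 := one_sub_pow_succ_ne_zero hq _
    have h2 : 1 - q ^ (3 * (n + 1)) ≠ 0 := one_sub_pow_succ_ne_zero hq (3 * n + 2)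
    rw [e1, e2, e3, e4, e5, ← pow_mul, ← pow_mul, pow_add q (3 * (n * (n + 1))),
      pow_add q (3 * n + 1), div_add_div_durfee h1 h2]
  · refine hasSum_pnat_of_hasSum_succ (f := fun n => q ^ (3 * n ^ 2 - n) *
      (1 - q ^ (6 * n - 1)) / ((1 - q ^ (3 * n - 1)) * (1 - q ^ (3 * n)))) ?_
    refine (hasSum_durfee hq3 hq2).congr_fun fun n => ?_
    have e1 : 3 * (n + 1) ^ 2 - (n + 1) = 3 * (n * (n + 1)) + 2 * (n + 1) := by
      rw [Nat.sub_eq_iff_eq_add (by nlinarith)]; ring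
    have e2 : 6 * (n + 1) - 1 = 3 * n + 2 + 3 * (n + 1) := by omega
    have e3 : 3 * (n + 1) - 1 = 3 * n + 2 := by omega
    have e4 : q ^ 2 * (q ^ 3) ^ n = q ^ (3 * n + 2) := by ring
    have e5 : (q ^ 3) ^ ((n + 1) * (n + 1)) = q ^ (3 * (n * (n + 1))) * q ^ (3 * (n + 1)) := by
      ring
    have h1 : 1 - q ^ (3 * n + 2) ≠ 0 := one_sub_pow_succ_ne_zero hq _
    have h2 : 1 - q ^ (3 * (n + 1)) ≠ 0 := one_sub_pow_succ_ne_zero hq (3 * n + 2)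
    rw [e1, e2, e3, e4, e5, ← pow_mul, ← pow_mul, ← pow_mul, pow_add q (3 * (n * (n + 1))),
      pow_add q (3 * n + 2), div_add_div_durfee h1 h2]
  · rw [cubicTheta_eq_lambertSeries hq]
    ring

lemma inv_mul_cube (hq0 : q ≠ 0) : q⁻¹ * q ^ 3 = q ^ 2 := by field_simp

lemma inv_sq_mul_cube (hq0 : q ≠ 0) : (q ^ 2)⁻¹ * q ^ 3 = q := by field_simp

lemma cubicTheta_baileyPair (hq0 : q ≠ 0) (hq : ‖q‖ < 1) {α β α' β' : ℕ → ℂ}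
    (h : IsBaileyPair q⁻¹ (q ^ 3) α β) (h' : IsBaileyPair (q ^ 2)⁻¹ (q ^ 3) α' β') {A₁ A₂ : ℂ}
    (hA₁ : SeriesTendsTo (fun n => qPoch (q ^ 3) (q ^ 3) (n - 1) * (-1) ^ n *
      q ^ ((3 * n ^ 2 + n) / 2) * α n / qPoch (q ^ 2) (q ^ 3) n) A₁)
    (hA₂ : SeriesTendsTo (fun n => qPoch (q ^ 3) (q ^ 3) (n - 1) * (-1) ^ n *
      q ^ ((3 * n ^ 2 - n) / 2) * α' n / qPoch q (q ^ 3) n) A₂) :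
    ∃ B₁ B₂ : ℂ,
      SeriesTendsTo (fun n => qPoch (q ^ 3) (q ^ 3) (n - 1) * (-1) ^ n *
        q ^ ((3 * n ^ 2 + n) / 2) * β n) B₁ ∧
      SeriesTendsTo (fun n => qPoch (q ^ 3) (q ^ 3) (n - 1) * (-1) ^ n *
        q ^ ((3 * n ^ 2 - n) / 2) * β' n) B₂ ∧
      cubicTheta q = 1 + 6 * B₁ - 6 * B₂ - 6 * A₁ + 6 * A₂ := by
  have hq2 : ‖q ^ 2‖ < 1 := norm_pow_succ_lt_one hq 1
  have hq3 : ‖q ^ 3‖ < 1 := norm_pow_succ_lt_one hq 2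
  obtain ⟨hα, -, hβ⟩ := h
  obtain ⟨hα', -, hβ'⟩ := h'
  rw [inv_mul_cube hq0] at hβ
  rw [inv_sq_mul_cube hq0] at hβ'
  rw [seriesTendsTo_iff] at hA₁ hA₂
  simp only [pow_pentagonal_add, pow_pentagonal_sub, ← mul_assoc] at hA₁ hA₂
  -- Here a = q⁻¹ gives x = a q³ = q², while a = q⁻² below gives x = q. The difference of the two
  -- transforms is the difference of Lambert series in a(q).
  have t₁ := tendsto_baileyTransform hq3 hq2 hα hβ hA₁
  have t₂ := tendsto_baileyTransform hq3 hq hα' hβ' hA₂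
  refine ⟨A₁ - lambertSeries (q ^ 2) (q ^ 3), A₂ - lambertSeries q (q ^ 3),
    seriesTendsTo_iff.2 ?_, seriesTendsTo_iff.2 ?_, ?_⟩
  · simp only [pow_pentagonal_add, ← mul_assoc]
    exact t₁
  · simp only [pow_pentagonal_sub, ← mul_assoc]
    exact t₂
  · rw [cubicTheta_eq_lambertSeries hq]
    ring

lemma one_sub_div_mul_pow_ne_zero {c : ℂ} (hc : c ≠ 0) {r m : ℕ} (h : c ≠ q ^ (3 * m + r)) :
    1 - q ^ r / c * (q ^ 3) ^ m ≠ 0 := by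
  intro h0
  apply h
  field_simp at h0
  rw [← pow_mul] at h0
  rw [pow_add]
  linear_combination h0

lemma one_sub_inv_pow_mul_pow_ne_zero (hq0 : q ≠ 0) (hq : ‖q‖ < 1) {r : ℕ} (hr : r = 1 ∨ r = 2)
    (m : ℕ) : 1 - (q ^ r)⁻¹ * (q ^ 3) ^ m ≠ 0 := by
  rcases m with _ | m
  · intro h0
    have h1 : q ^ r = 1 := by
      rw [pow_zero, mul_one, sub_eq_zero, eq_comm, inv_eq_one] at h0
      exact h0
    have h2 : ‖q ^ r‖ < 1 := by
      rw [norm_pow]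
      exact pow_lt_one₀ (norm_nonneg q) hq (by omega)
    rw [h1, norm_one] at h2
    exact lt_irrefl _ h2
  · have e : (q ^ r)⁻¹ * (q ^ 3) ^ (m + 1) = q ^ (3 * m + (2 - r) + 1) := by
      rw [inv_mul_eq_iff_eq_mul₀ (pow_ne_zero r hq0), ← pow_mul, ← pow_add]
      congr 1
      omega
    rw [e]
    exact one_sub_pow_succ_ne_zero hq _

/-- The general term of the series containing `α_n` of the two-parameter pair. -/
lemma baileyWeight_mul_wellPoisedAlpha {a c d p x : ℂ} (hx : a * p = x) (n : ℕ) :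
    baileyWeight x p n * wellPoisedAlpha c d a p (n + 1) / qPoch x p (n + 1) =
      (1 - a * p ^ (2 * (n + 1))) * qPoch p p n *
        (qPoch a p (n + 1) * qPoch c p (n + 1) * qPoch d p (n + 1)) *
        (p ^ ((n + 1).choose 2) * p ^ ((n + 1).choose 2) * (x ^ (n + 1) * x ^ (n + 1))) /
      ((1 - a) * (qPoch (x / c) p (n + 1) * qPoch (x / d) p (n + 1) * qPoch x p (n + 1) *
        qPoch p p (n + 1)) * c ^ (n + 1) * d ^ (n + 1)) := by
  -- The sign of the weight cancels the sign in α, so no alternating factor remains in the α-series.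
  have e : (-1 : ℂ) ^ (n + 1) * (-1) ^ (n + 1) = 1 := by
    rw [← mul_pow]; norm_num
  rw [baileyWeight, wellPoisedAlpha, hx, div_pow, mul_pow c d]
  generalize 1 - a * p ^ (2 * (n + 1)) = D1
  generalize 1 - a = D2
  generalize (-1 : ℂ) ^ (n + 1) = s at *
  calc _ = (s * s) * (D1 * qPoch p p n *
        (qPoch a p (n + 1) * qPoch c p (n + 1) * qPoch d p (n + 1)) *
        (p ^ ((n + 1).choose 2) * p ^ ((n + 1).choose 2) * (x ^ (n + 1) * x ^ (n + 1))) /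
      (D2 * (qPoch (x / c) p (n + 1) * qPoch (x / d) p (n + 1) * qPoch x p (n + 1) *
        qPoch p p (n + 1)) * c ^ (n + 1) * d ^ (n + 1))) := by
        simp only [div_eq_mul_inv, mul_inv]
        ring
    _ = _ := by rw [e, one_mul]

lemma cubicTheta_two_parameters (hq0 : q ≠ 0) (hq : ‖q‖ < 1) {c d : ℂ} (hc : c ≠ 0) (hd : d ≠ 0)
    (hcd : ∀ m : ℕ, c ≠ q ^ (3 * m + 1) ∧ c ≠ q ^ (3 * m + 2) ∧
      d ≠ q ^ (3 * m + 1) ∧ d ≠ q ^ (3 * m + 2)) :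
    ∃ S₁ S₂ S₃ S₄ : ℂ,
        HasSum (fun n : ℕ+ =>
          qPoch (q ^ 3) (q ^ 3) (n - 1) * qPoch (q ^ 2 / (c * d)) (q ^ 3) n *
              (-1) ^ (n : ℕ) * q ^ ((3 * (n : ℕ) ^ 2 + n) / 2) /
            (qPoch (q ^ 2 / c) (q ^ 3) n * qPoch (q ^ 2 / d) (q ^ 3) n *
              qPoch (q ^ 3) (q ^ 3) n)) S₁ ∧
        HasSum (fun n : ℕ+ =>
          qPoch (q ^ 3) (q ^ 3) (n - 1) * qPoch (q / (c * d)) (q ^ 3) n *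
              (-1) ^ (n : ℕ) * q ^ ((3 * (n : ℕ) ^ 2 - n) / 2) /
            (qPoch (q / c) (q ^ 3) n * qPoch (q / d) (q ^ 3) n *
              qPoch (q ^ 3) (q ^ 3) n)) S₂ ∧
        HasSum (fun n : ℕ+ =>
          (1 - q ^ (6 * (n : ℕ) - 1)) * qPoch (q ^ 3) (q ^ 3) (n - 1) *
              (qPoch (1 / q) (q ^ 3) n * qPoch c (q ^ 3) n * qPoch d (q ^ 3) n) *
              q ^ (3 * (n : ℕ) ^ 2 + n) /
            ((1 - 1 / q) * (qPoch (q ^ 2 / c) (q ^ 3) n * qPoch (q ^ 2 / d) (q ^ 3) n *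
              qPoch (q ^ 2) (q ^ 3) n * qPoch (q ^ 3) (q ^ 3) n) *
              c ^ (n : ℕ) * d ^ (n : ℕ))) S₃ ∧
        HasSum (fun n : ℕ+ =>
          (1 - q ^ (6 * (n : ℕ) - 2)) * qPoch (q ^ 3) (q ^ 3) (n - 1) *
              (qPoch (1 / q ^ 2) (q ^ 3) n * qPoch c (q ^ 3) n * qPoch d (q ^ 3) n) *
              q ^ (3 * (n : ℕ) ^ 2 - n) /
            ((1 - 1 / q ^ 2) * (qPoch (q / c) (q ^ 3) n * qPoch (q / d) (q ^ 3) n *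
              qPoch q (q ^ 3) n * qPoch (q ^ 3) (q ^ 3) n) *
              c ^ (n : ℕ) * d ^ (n : ℕ))) S₄ ∧
        cubicTheta q = 1 + 6 * S₁ - 6 * S₂ - 6 * S₃ + 6 * S₄ := by
  have hq2 : ‖q ^ 2‖ < 1 := norm_pow_succ_lt_one hq 1
  have hq3 : ‖q ^ 3‖ < 1 := norm_pow_succ_lt_one hq 2
  -- For x = q² the denominators vanish only if c or d is some q^(3m+2); for x = q, treated next,
  -- only if one is some q^(3m+1).
  obtain ⟨A₁, B₁, hB₁, hA₁, hAB₁⟩ := tsum_wellPoised hq3 hq2 (inv_mul_cube hq0) hc hd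
    (by simpa using one_sub_inv_pow_mul_pow_ne_zero hq0 hq (Or.inl rfl))
    (fun m => one_sub_div_mul_pow_ne_zero hc (hcd m).2.1)
    (fun m => one_sub_div_mul_pow_ne_zero hd (hcd m).2.2.2)
  obtain ⟨A₂, B₂, hB₂, hA₂, hAB₂⟩ := tsum_wellPoised hq3 hq (inv_sq_mul_cube hq0) hc hd
    (one_sub_inv_pow_mul_pow_ne_zero hq0 hq (Or.inr rfl))
    (fun m => by simpa using one_sub_div_mul_pow_ne_zero hc (r := 1) (hcd m).1)
    (fun m => by simpa using one_sub_div_mul_pow_ne_zero hd (r := 1) (hcd m).2.2.1)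
  simp only [baileyWeight_mul_wellPoisedAlpha (inv_mul_cube hq0)] at hA₁
  simp only [baileyWeight_mul_wellPoisedAlpha (inv_sq_mul_cube hq0)] at hA₂
  refine ⟨B₁, B₂, A₁, A₂, ?_, ?_, ?_, ?_, ?_⟩
  · refine hasSum_pnat_of_hasSum_succ (f := fun n =>
      qPoch (q ^ 3) (q ^ 3) (n - 1) * qPoch (q ^ 2 / (c * d)) (q ^ 3) n *
        (-1) ^ n * q ^ ((3 * n ^ 2 + n) / 2) /
        (qPoch (q ^ 2 / c) (q ^ 3) n * qPoch (q ^ 2 / d) (q ^ 3) n * qPoch (q ^ 3) (q ^ 3) n)) ?_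
    refine hB₁.congr_fun fun n => ?_
    rw [pow_pentagonal_add, baileyWeight, wellPoisedBeta, inv_mul_cube hq0, Nat.add_sub_cancel]
    ring
  · refine hasSum_pnat_of_hasSum_succ (f := fun n =>
      qPoch (q ^ 3) (q ^ 3) (n - 1) * qPoch (q / (c * d)) (q ^ 3) n *
        (-1) ^ n * q ^ ((3 * n ^ 2 - n) / 2) /
        (qPoch (q / c) (q ^ 3) n * qPoch (q / d) (q ^ 3) n * qPoch (q ^ 3) (q ^ 3) n)) ?_
    refine hB₂.congr_fun fun n => ?_
    rw [pow_pentagonal_sub, baileyWeight, wellPoisedBeta, inv_sq_mul_cube hq0, Nat.add_sub_cancel]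
    ring
  · refine hasSum_pnat_of_hasSum_succ (f := fun n =>
      (1 - q ^ (6 * n - 1)) * qPoch (q ^ 3) (q ^ 3) (n - 1) *
        (qPoch (1 / q) (q ^ 3) n * qPoch c (q ^ 3) n * qPoch d (q ^ 3) n) *
        q ^ (3 * n ^ 2 + n) /
        ((1 - 1 / q) * (qPoch (q ^ 2 / c) (q ^ 3) n * qPoch (q ^ 2 / d) (q ^ 3) n *
        qPoch (q ^ 2) (q ^ 3) n * qPoch (q ^ 3) (q ^ 3) n) * c ^ n * d ^ n)) ?_
    refine hA₁.congr_fun fun n => ?_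
    have e1 : q⁻¹ * (q ^ 3) ^ (2 * (n + 1)) = q ^ (6 * (n + 1) - 1) := by
      rw [inv_mul_eq_iff_eq_mul₀ hq0, ← pow_mul, ← pow_succ']
      congr 1
      omega
    have e2 : (q ^ 3) ^ ((n + 1).choose 2) * (q ^ 3) ^ ((n + 1).choose 2) *
        ((q ^ 2) ^ (n + 1) * (q ^ 2) ^ (n + 1)) = q ^ (3 * (n + 1) ^ 2 + (n + 1)) := by
      simp only [← pow_mul, ← pow_add]
      congr 1
      have := two_mul_choose_two_add (n + 1)
      omega
    rw [e1, e2, one_div, Nat.add_sub_cancel]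
  · refine hasSum_pnat_of_hasSum_succ (f := fun n =>
      (1 - q ^ (6 * n - 2)) * qPoch (q ^ 3) (q ^ 3) (n - 1) *
        (qPoch (1 / q ^ 2) (q ^ 3) n * qPoch c (q ^ 3) n * qPoch d (q ^ 3) n) *
        q ^ (3 * n ^ 2 - n) /
        ((1 - 1 / q ^ 2) * (qPoch (q / c) (q ^ 3) n * qPoch (q / d) (q ^ 3) n *
        qPoch q (q ^ 3) n * qPoch (q ^ 3) (q ^ 3) n) * c ^ n * d ^ n)) ?_
    refine hA₂.congr_fun fun n => ?_
    have e1 : (q ^ 2)⁻¹ * (q ^ 3) ^ (2 * (n + 1)) = q ^ (6 * (n + 1) - 2) := by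
      rw [inv_mul_eq_iff_eq_mul₀ (pow_ne_zero 2 hq0), ← pow_mul, ← pow_add]
      congr 1
      omega
    have e2 : (q ^ 3) ^ ((n + 1).choose 2) * (q ^ 3) ^ ((n + 1).choose 2) *
        (q ^ (n + 1) * q ^ (n + 1)) = q ^ (3 * (n + 1) ^ 2 - (n + 1)) := by
      simp only [← pow_mul, ← pow_add]
      congr 1
      have := two_mul_choose_two_add (n + 1)
      omega
    rw [e1, e2, one_div, Nat.add_sub_cancel]
  · rw [cubicTheta_eq_lambertSeries hq, hAB₁, hAB₂]
    ring

end Expansions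

theorem mainTheorem8 :
    -- the double series for `a(q)` converges absolutely, and the first two expansions
    (∀ q : ℂ, ‖q‖ < 1 →
      Summable (fun p : ℤ × ℤ => q ^ (p.1 ^ 2 + p.1 * p.2 + p.2 ^ 2)) ∧
      (∃ S₁ S₂ : ℂ,
        HasSum (fun n : ℕ+ => (-1 : ℂ) ^ (n : ℕ) * q ^ ((3 * (n : ℕ) ^ 2 - n) / 2) /
          (qPoch q (q ^ 3) n * (1 - q ^ (3 * (n : ℕ))))) S₁ ∧
        HasSum (fun n : ℕ+ => (-1 : ℂ) ^ (n : ℕ) * q ^ ((3 * (n : ℕ) ^ 2 + n) / 2) /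
          (qPoch (q ^ 2) (q ^ 3) n * (1 - q ^ (3 * (n : ℕ))))) S₂ ∧
        cubicTheta q = 1 - 6 * S₁ + 6 * S₂) ∧
      (∃ S₁ S₂ : ℂ,
        HasSum (fun n : ℕ+ => q ^ (3 * (n : ℕ) ^ 2 - 2 * n) * (1 - q ^ (6 * (n : ℕ) - 2)) /
          ((1 - q ^ (3 * (n : ℕ) - 2)) * (1 - q ^ (3 * (n : ℕ))))) S₁ ∧
        HasSum (fun n : ℕ+ => q ^ (3 * (n : ℕ) ^ 2 - n) * (1 - q ^ (6 * (n : ℕ) - 1)) /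
          ((1 - q ^ (3 * (n : ℕ) - 1)) * (1 - q ^ (3 * (n : ℕ))))) S₂ ∧
        cubicTheta q = 1 + 6 * S₁ - 6 * S₂)) ∧
    -- the general formula, for every Bailey pair `(α_n(a, q), β_n(a, q))` with free parameter `a`
    (∀ q : ℂ, 0 < ‖q‖ → ‖q‖ < 1 →
      ∀ α β : ℂ → ℂ → ℕ → ℂ,
        IsBaileyPair q⁻¹ (q ^ 3) (α q⁻¹ (q ^ 3)) (β q⁻¹ (q ^ 3)) →
        IsBaileyPair (q ^ 2)⁻¹ (q ^ 3) (α (q ^ 2)⁻¹ (q ^ 3)) (β (q ^ 2)⁻¹ (q ^ 3)) →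
      ∀ A₁ A₂ : ℂ,
        SeriesTendsTo (fun n => qPoch (q ^ 3) (q ^ 3) (n - 1) * (-1) ^ n *
          q ^ ((3 * n ^ 2 + n) / 2) * α q⁻¹ (q ^ 3) n / qPoch (q ^ 2) (q ^ 3) n) A₁ →
        SeriesTendsTo (fun n => qPoch (q ^ 3) (q ^ 3) (n - 1) * (-1) ^ n *
          q ^ ((3 * n ^ 2 - n) / 2) * α (q ^ 2)⁻¹ (q ^ 3) n / qPoch q (q ^ 3) n) A₂ →
      ∃ B₁ B₂ : ℂ,
        SeriesTendsTo (fun n => qPoch (q ^ 3) (q ^ 3) (n - 1) * (-1) ^ n *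
          q ^ ((3 * n ^ 2 + n) / 2) * β q⁻¹ (q ^ 3) n) B₁ ∧
        SeriesTendsTo (fun n => qPoch (q ^ 3) (q ^ 3) (n - 1) * (-1) ^ n *
          q ^ ((3 * n ^ 2 - n) / 2) * β (q ^ 2)⁻¹ (q ^ 3) n) B₂ ∧
        cubicTheta q = 1 + 6 * B₁ - 6 * B₂ - 6 * A₁ + 6 * A₂) ∧
    -- the formula with two free parameters `c` and `d`
    (∀ q : ℂ, 0 < ‖q‖ → ‖q‖ < 1 →
      ∀ c d : ℂ, c ≠ 0 → d ≠ 0 →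
        (∀ m : ℕ, c ≠ q ^ (3 * m + 1) ∧ c ≠ q ^ (3 * m + 2) ∧
          d ≠ q ^ (3 * m + 1) ∧ d ≠ q ^ (3 * m + 2)) →
      ∃ S₁ S₂ S₃ S₄ : ℂ,
        HasSum (fun n : ℕ+ =>
          qPoch (q ^ 3) (q ^ 3) (n - 1) * qPoch (q ^ 2 / (c * d)) (q ^ 3) n *
              (-1) ^ (n : ℕ) * q ^ ((3 * (n : ℕ) ^ 2 + n) / 2) /
            (qPoch (q ^ 2 / c) (q ^ 3) n * qPoch (q ^ 2 / d) (q ^ 3) n *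
              qPoch (q ^ 3) (q ^ 3) n)) S₁ ∧
        HasSum (fun n : ℕ+ =>
          qPoch (q ^ 3) (q ^ 3) (n - 1) * qPoch (q / (c * d)) (q ^ 3) n *
              (-1) ^ (n : ℕ) * q ^ ((3 * (n : ℕ) ^ 2 - n) / 2) /
            (qPoch (q / c) (q ^ 3) n * qPoch (q / d) (q ^ 3) n *
              qPoch (q ^ 3) (q ^ 3) n)) S₂ ∧
        HasSum (fun n : ℕ+ =>
          (1 - q ^ (6 * (n : ℕ) - 1)) * qPoch (q ^ 3) (q ^ 3) (n - 1) *
              (qPoch (1 / q) (q ^ 3) n * qPoch c (q ^ 3) n * qPoch d (q ^ 3) n) *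
              q ^ (3 * (n : ℕ) ^ 2 + n) /
            ((1 - 1 / q) * (qPoch (q ^ 2 / c) (q ^ 3) n * qPoch (q ^ 2 / d) (q ^ 3) n *
              qPoch (q ^ 2) (q ^ 3) n * qPoch (q ^ 3) (q ^ 3) n) *
              c ^ (n : ℕ) * d ^ (n : ℕ))) S₃ ∧
        HasSum (fun n : ℕ+ =>
          (1 - q ^ (6 * (n : ℕ) - 2)) * qPoch (q ^ 3) (q ^ 3) (n - 1) *
              (qPoch (1 / q ^ 2) (q ^ 3) n * qPoch c (q ^ 3) n * qPoch d (q ^ 3) n) *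
              q ^ (3 * (n : ℕ) ^ 2 - n) /
            ((1 - 1 / q ^ 2) * (qPoch (q / c) (q ^ 3) n * qPoch (q / d) (q ^ 3) n *
              qPoch q (q ^ 3) n * qPoch (q ^ 3) (q ^ 3) n) *
              c ^ (n : ℕ) * d ^ (n : ℕ))) S₄ ∧
        cubicTheta q = 1 + 6 * S₁ - 6 * S₂ - 6 * S₃ + 6 * S₄) := by
  refine ⟨fun q hq => ⟨(summable_norm_cubicTheta hq).of_norm, cubicTheta_alternating hq,
    cubicTheta_durfee hq⟩, fun q hq0 hq α β h h' A₁ A₂ hA₁ hA₂ => ?_,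
    fun q hq0 hq c d hc hd hcd => ?_⟩
  · exact cubicTheta_baileyPair (norm_pos_iff.1 hq0) hq h h' hA₁ hA₂
  · exact cubicTheta_two_parameters (norm_pos_iff.1 hq0) hq hc hd hcd
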